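/- Let $F$ be a field with a discrete valuation $v$ (value group $\cong \mathbb{Z}$) that is nondyadic, i.e. whose residue field $\bar F$ has characteristic $\ne 2$. For nonzero $a_1,\dots,a_d$ in a field put $\langle\!\langle a_1,\dots,a_d\rangle\!\rangle := \bigotimes_{i=1}^d \langle 1,-a_i\rangle$; a $d$-Pfister form is a quadratic form isometric to one of these. A form $\gamma$ divides a form $\phi$ if $\phi\cong\gamma\otimes\delta$ for some quadratic form $\delta$. Let $\pi$ be a uniformizer of $F$. Every nondegenerate form $\phi$ over $F$ can be written as $\phi\cong\langle u_1,\dots,u_m\rangle\perp\pi\langle w_1,\dots,w_n\rangle$ with all $u_i,w_j$ of value $0$; we say that $\phi$ is ramified (at $v$) if its second residue form $\langle\bar w_1,\dots,\bar w_n\rangle$ is nonzero in the Witt group of $\bar F$, i.e. is not hyperbolic. A ramified $d$-Pfister form $\phi$ can be written as $\phi\cong\langle\!\langle a_1,\dots,a_{d-1},b\rangle\!\rangle$ with $v(a_i)=0$ for all $i$ and $v(b)=1$; its ramification (residue form) is the $(d-1)$-Pfister form $r(\phi)=\langle\!\langle\bar a_1,\dots,\bar a_{d-1}\rangle\!\rangle$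 over $\bar F$, which is well defined up to isometry. Let $d\ge 2$ and let $\phi_1,\phi_2$ be $d$-Pfister forms over $F$. If 1. $\phi_1$ is ramified and $\phi_2$ is not; or 2. $\phi_1$ and $\phi_2$ are both ramified, but $r(\phi_1)$ and $r(\phi_2)$ are not isometric, then there is a $(d-1)$-Pfister form $\gamma$ over $F$ such that $\gamma$ divides $\phi_1$ or $\phi_2$ but not both. -/

import Mathlib

namespace PfisterRam

/-- The diagonal quadratic form `⟨c_i⟩_i`, that is `∑ i, c_i x_i²`. -/
noncomputable def diagForm {K : Type*} [Field K] {ι : Type*} [Fintype ι] (c : ι → K) :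
    QuadraticForm K (ι → K) :=
  QuadraticMap.weightedSumSquares K c

/-- The form `⟪a_1, …, a_d⟫ = ⟨1, -a_1⟩ ⊗ ⋯ ⊗ ⟨1, -a_d⟩`, expanded as the diagonal form whose
entries are the products `∏ i ∈ S, (-a_i)` over all subsets `S` of the index set. -/
noncomputable def pfister {K : Type*} [Field K] {d : ℕ} (a : Fin d → K) :
    QuadraticForm K (Finset (Fin d) → K) :=
  diagForm fun S : Finset (Fin d) => ∏ i ∈ S, (-a i)

/-- `φ` is a `d`-Pfister form: it is isometric to `⟪a_1, …, a_d⟫` with all `a_i` nonzero. -/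
def IsPfister {K V : Type*} [Field K] [AddCommGroup V] [Module K V] (d : ℕ)
    (φ : QuadraticForm K V) : Prop :=
  ∃ a : Fin d → K, (∀ i, a i ≠ 0) ∧ φ.Equivalent (pfister a)

/-- `γ` divides `φ`: there is a (finite-dimensional) quadratic form `δ` with `φ ≅ γ ⊗ δ`. -/
def Divides {K V W : Type*} [Field K] [Invertible (2 : K)] [AddCommGroup V] [Module K V]
    [AddCommGroup W] [Module K W] (γ : QuadraticForm K W) (φ : QuadraticForm K V) : Prop :=
  ∃ (n : ℕ) (δ : QuadraticForm K (Fin n → K)), φ.Equivalent (QuadraticForm.tmul γ δ)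

/-- `φ` is hyperbolic (possibly zero-dimensional): it is isometric to the form `(f, x) ↦ f x`
on `U* × U` for a finite-dimensional space `U`.  Over a field of characteristic not two, the
hyperbolic forms are the nondegenerate forms whose class in the Witt group is zero. -/
def IsHyperbolic {K V : Type*} [Field K] [AddCommGroup V] [Module K V]
    (φ : QuadraticForm K V) : Prop :=
  ∃ n : ℕ, φ.Equivalent (QuadraticForm.dualProd K (Fin n → K))

section Residue

variable {F V Γ : Type*} [Field F] [LinearOrderedCommGroupWithZero Γ] (v : Valuation F Γ)

/-- The residue field of a valuation. -/
abbrev ResField : Type _ := IsLocalRing.ResidueField v.valuationSubring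

/-- The image in the residue field of a unit of the valuation ring, i.e. of an element of
value zero (in additive notation). -/
noncomputable def res (u : v.valuationSubringˣ) : ResField v :=
  IsLocalRing.residue v.valuationSubring (u : v.valuationSubring)

/-- A unit of the valuation ring as an element of the field. -/
def toF (u : v.valuationSubringˣ) : F := ((u : v.valuationSubring) : F)

variable [AddCommGroup V] [Module F V]

/-- `ρ` is a second residue form of `φ` with respect to `π`: there are units `u_i`, `w_j` of the
valuation ring with `φ ≅ ⟨u_1, …, u_m⟩ ⊥ π ⟨w_1, …, w_n⟩`, and `ρ` is the form `⟨w̄_1, …, w̄_n⟩`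
over the residue field. -/
def IsSecondResidueForm (π : F) (φ : QuadraticForm F V) {n : ℕ}
    (ρ : QuadraticForm (ResField v) (Fin n → ResField v)) : Prop :=
  ∃ (m : ℕ) (u : Fin m → v.valuationSubringˣ) (w : Fin n → v.valuationSubringˣ),
    φ.Equivalent (diagForm (Sum.elim (fun i => toF v (u i)) (fun j => π * toF v (w j)))) ∧
    ρ = diagForm fun j => res v (w j)

/-- `φ` is ramified at the discrete valuation `v`: its second residue form with respect to a
uniformizer is not zero in the Witt group of the residue field. -/
def IsRamified [v.IsRankOneDiscrete] (φ : QuadraticForm F V) : Prop :=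
  ∃ π : F, v.IsUniformizer π ∧
    ∃ (n : ℕ) (ρ : QuadraticForm (ResField v) (Fin n → ResField v)),
      IsSecondResidueForm v π φ ρ ∧ ¬ IsHyperbolic ρ

/-- `ρ` is the ramification (the residue form `r(φ)`) of the Pfister form `φ`: one can write
`φ ≅ ⟪a_1, …, a_e, b⟫` with all `a_i` of value zero and `b` of value one, and `ρ` is the
Pfister form `⟪ā_1, …, ā_e⟫` over the residue field. -/
def IsRamification [v.IsRankOneDiscrete] (φ : QuadraticForm F V) {W : Type*} [AddCommGroup W]
    [Module (ResField v) W] (ρ : QuadraticForm (ResField v) W) : Prop :=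
  ∃ (e : ℕ) (a : Fin e → v.valuationSubringˣ) (b : F), v.IsUniformizer b ∧
    φ.Equivalent (pfister (Fin.snoc (fun i => toF v (a i)) b : Fin (e + 1) → F)) ∧
    ρ.Equivalent (pfister fun i => res v (a i))

end Residue

/-- `φ₁` and `φ₂` have different ramification: their residue forms are not isometric. -/
def DifferentRamification {F V₁ V₂ Γ : Type*} [Field F] [LinearOrderedCommGroupWithZero Γ]
    (v : Valuation F Γ) [v.IsRankOneDiscrete] [AddCommGroup V₁] [Module F V₁]
    [AddCommGroup V₂] [Module F V₂] (d : ℕ)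
    (φ₁ : QuadraticForm F V₁) (φ₂ : QuadraticForm F V₂) : Prop :=
  ∃ ρ₁ ρ₂ : QuadraticForm (ResField v) (Finset (Fin (d - 1)) → ResField v),
    IsRamification v φ₁ ρ₁ ∧ IsRamification v φ₂ ρ₂ ∧ ¬ ρ₁.Equivalent ρ₂

end PfisterRam

/-! Everything rests on the fact that isometric forms have Witt equivalent residue forms. The graph
of an isometry is a Lagrangian (a subspace equal to its own orthogonal complement) of the difference
of the two forms. Its intersection with a suitable lattice reduces to a Lagrangian of the difference
of the second residue forms (`IsLagrangian.exists_residue`). Scaling by a uniformizer gives the same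
for first residue forms. An anisotropic residue form is therefore of least dimension in its class,
and determined by its class and dimension.

Since `v` need not be complete, an isotropic residue form does not make a Pfister form isotropic. By
roundness, however, a Pfister form with unit slots and isotropic residue has a slot `f` of residue 1
(`exists_slot_res_eq_one`). Multiples of `⟨1, -f⟩` have second residue `w ⊥ -w`, so they are
unramified (`not_isRamified_of_dbl`).

Suppose only `φ₁` is ramified. All slots but one may be taken to be units (`exists_unit_slots`). If
`φ₂` acquires a slot `f` of residue 1, a divisor of `φ₂` containing that slot cannot divide `φ₁`.
Otherwise `φ₂` has unit slots and anisotropic residue, and a divisor of `φ₁` with a uniformizer slot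
cannot divide `φ₂`: multiples of `⟨1, -πu⟩` have residue forms of equal dimension, whereas the first
residue of `φ₂` is anisotropic of full dimension.

If both are ramified, let `γ` lift `r(φ₁)`. Both residue forms of `φ₂` are anisotropic. If `γ`
divided `φ₂`, counting dimensions would make a multiple of `r(φ₁)` isometric to `r(φ₂)`, and
roundness would remove the scalar. -/

namespace PfisterRam

/-! ### Diagonal forms: isometries, roundness, tensor products. -/

section Diagonal

variable {K ι κ ι' κ' μ : Type*} [Field K]

/-- The diagonal form `⟨1, x⟩ ⊗ c`. -/
def dbl (x : K) (c : ι → K) : ι ⊕ ι → K := Sum.elim c (x • c)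

theorem dbl_smul (x e : K) (c : ι → K) : dbl x (e • c) = e • dbl x c := by
  ext (i | i) <;> simp [PfisterRam.dbl]; ring

variable [Fintype ι] [Fintype κ] [Fintype ι'] [Fintype κ'] [Fintype μ]

/-- Two diagonal forms are isometric. -/
abbrev DiagIso (c : ι → K) (c' : κ → K) : Prop := (diagForm c).Equivalent (diagForm c')

theorem diagForm_apply (c x : ι → K) : diagForm c x = ∑ i, c i * (x i * x i) := by
  simp [diagForm, QuadraticMap.weightedSumSquares_apply]

theorem DiagIso.refl (c : ι → K) : DiagIso c c := QuadraticMap.Equivalent.refl _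

theorem DiagIso.symm {c : ι → K} {c' : κ → K} (h : DiagIso c c') : DiagIso c' c :=
  QuadraticMap.Equivalent.symm h

theorem DiagIso.trans {c : ι → K} {c' : κ → K} {c'' : μ → K} (h : DiagIso c c')
    (h' : DiagIso c' c'') : DiagIso c c'' :=
  QuadraticMap.Equivalent.trans h h'

theorem diagIso_of_linearEquiv {c : ι → K} {c' : κ → K} (f : (ι → K) ≃ₗ[K] (κ → K))
    (h : ∀ x, diagForm c' (f x) = diagForm c x) : DiagIso c c' :=
  ⟨⟨f, h⟩⟩

theorem diagIso_of_equiv {c : ι → K} {c' : κ → K} (e : ι ≃ κ) (h : ∀ i, c i = c' (e i)) :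
    DiagIso c c' := by
  refine diagIso_of_linearEquiv (LinearEquiv.funCongrLeft K K e.symm) fun x => ?_
  simp only [diagForm_apply, LinearEquiv.funCongrLeft_apply, LinearMap.funLeft_apply]
  exact (Fintype.sum_equiv e _ _ (by simp [h])).symm

theorem diagIso_of_sq {c c' : ι → K} (t : ι → K) (ht : ∀ i, t i ≠ 0)
    (h : ∀ i, c i = t i ^ 2 * c' i) : DiagIso c c' := by
  refine diagIso_of_linearEquiv
    (LinearEquiv.piCongrRight fun i => LinearEquiv.smulOfNeZero K K (t i) (ht i)) fun x => ?_
  simp only [diagForm_apply, LinearEquiv.piCongrRight_apply, LinearEquiv.smulOfNeZero_apply,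
    smul_eq_mul, h]
  exact Finset.sum_congr rfl fun i _ => by ring

theorem diagIso_of_equiv_sq {c : ι → K} {c' : κ → K} (e : ι ≃ κ) (t : ι → K) (ht : ∀ i, t i ≠ 0)
    (h : ∀ i, c i = t i ^ 2 * c' (e i)) : DiagIso c c' :=
  (diagIso_of_sq (c' := c' ∘ e) t ht h).trans (diagIso_of_equiv e fun _ => rfl)

theorem diagIso_of_eq {c c' : ι → K} (h : ∀ i, c i = c' i) : DiagIso c c' :=
  diagIso_of_equiv (Equiv.refl _) h

theorem diagForm_sumElim (a : ι → K) (b : κ → K) (x : ι ⊕ κ → K) :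
    diagForm (Sum.elim a b) x
      = diagForm a (fun i => x (Sum.inl i)) + diagForm b (fun i => x (Sum.inr i)) := by
  simp [diagForm_apply]

theorem diagForm_smul (e : K) (c x : ι → K) : diagForm (e • c) x = e * diagForm c x := by
  simp [diagForm_apply, Finset.mul_sum, mul_assoc]

theorem DiagIso.sumElim {a : ι → K} {b : κ → K} {a' : ι' → K} {b' : κ' → K}
    (ha : DiagIso a a') (hb : DiagIso b b') : DiagIso (Sum.elim a b) (Sum.elim a' b') := by
  obtain ⟨f⟩ := ha
  obtain ⟨g⟩ := hb
  refine diagIso_of_linearEquiv ((LinearEquiv.sumArrowLequivProdArrow ι κ K K).trans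
    ((f.toLinearEquiv.prodCongr g.toLinearEquiv).trans
      (LinearEquiv.sumArrowLequivProdArrow ι' κ' K K).symm)) fun x => ?_
  rw [diagForm_sumElim, diagForm_sumElim]
  exact congrArg₂ _ (f.map_app _) (g.map_app _)

theorem DiagIso.smul {a : ι → K} {a' : ι' → K} (e : K) (h : DiagIso a a') :
    DiagIso (e • a) (e • a') := by
  obtain ⟨f⟩ := h
  refine diagIso_of_linearEquiv f.toLinearEquiv fun x => ?_
  rw [diagForm_smul, diagForm_smul]
  exact congrArg _ (f.map_app _)

theorem DiagIso.card_eq {a : ι → K} {a' : ι' → K} (h : DiagIso a a') :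
    Fintype.card ι = Fintype.card ι' := by
  obtain ⟨f⟩ := h
  simpa using f.toLinearEquiv.finrank_eq

theorem DiagIso.dbl {c : ι → K} {c' : κ → K} (x : K) (h : DiagIso c c') :
    DiagIso (dbl x c) (dbl x c') :=
  h.sumElim (h.smul x)

theorem dbl_comm (x y : K) (c : ι → K) : DiagIso (dbl x (dbl y c)) (dbl y (dbl x c)) :=
  diagIso_of_equiv (Equiv.sumSumSumComm ι ι ι ι) (by
    rintro ((i | i) | (i | i)) <;> simp [PfisterRam.dbl]; ring)

theorem dbl_sq_mul {t : K} (ht : t ≠ 0) (x : K) (c : ι → K) :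
    DiagIso (dbl (t ^ 2 * x) c) (dbl x c) :=
  diagIso_of_sq (Sum.elim (fun _ => 1) fun _ => t) (by rintro (i | i) <;> simp [ht])
    (by rintro (i | i) <;> simp [PfisterRam.dbl]; ring)

/-- Scaling by `y` preserves `⟨1, y⟩ ⊗ c`: it swaps the two copies of `c` up to the square `y²`. -/
theorem dbl_mul_dbl {y : K} (hy : y ≠ 0) (x : K) (c : ι → K) :
    DiagIso (dbl (x * y) (dbl y c)) (dbl x (dbl y c)) :=
  diagIso_of_equiv_sq ((Equiv.refl (ι ⊕ ι)).sumCongr (Equiv.sumComm ι ι))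
    (Sum.elim (fun _ => 1) (Sum.elim (fun _ => 1) fun _ => y))
    (by rintro (i | (i | i)) <;> simp [hy])
    (by rintro ((i | i) | (i | i)) <;> simp [PfisterRam.dbl] <;> ring)

/-- The binary identity `⟨s, r⟩ ≅ ⟨s + r, (s + r)sr⟩`, applied to each entry of `c`. The
substitution `(x, y) ↦ (x - ry, x + sy)` has determinant `s + r`. -/
theorem sumElim_smul_smul_diagIso {s r : K} (h : s + r ≠ 0) (c : ι → K) :
    DiagIso (Sum.elim (s • c) (r • c)) (Sum.elim ((s + r) • c) (((s + r) * (s * r)) • c)) := by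
  let g : (ι ⊕ ι → K) →ₗ[K] (ι ⊕ ι → K) :=
    { toFun := fun z => Sum.elim (fun i => z (Sum.inl i) - r * z (Sum.inr i))
        fun i => z (Sum.inl i) + s * z (Sum.inr i)
      map_add' := fun z w => by ext (i | i) <;> simp <;> ring
      map_smul' := fun a z => by ext (i | i) <;> simp <;> ring }
  have hg : Function.Injective g := by
    rw [injective_iff_map_eq_zero]
    intro z hz
    have h1 : ∀ i, z (Sum.inl i) - r * z (Sum.inr i) = 0 := fun i => congrFun hz (Sum.inl i)
    have h2 : ∀ i, z (Sum.inl i) + s * z (Sum.inr i) = 0 := fun i => congrFun hz (Sum.inr i)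
    have h3 : ∀ i, z (Sum.inr i) = 0 := fun i =>
      (mul_eq_zero.1 (show (s + r) * z (Sum.inr i) = 0 by
        linear_combination h2 i - h1 i)).resolve_left h
    ext (i | i)
    · simpa [h3] using h1 i
    · exact h3 i
  refine (diagIso_of_linearEquiv (LinearEquiv.ofInjectiveEndo g hg) fun z => ?_).symm
  rw [LinearEquiv.coe_ofInjectiveEndo, diagForm_sumElim, diagForm_sumElim]
  simp only [diagForm_apply, ← Finset.sum_add_distrib]
  refine Finset.sum_congr rfl fun i _ => ?_
  simp [g]
  ring

/-- A diagonal form is round if it is isometric to its multiples by nonzero values. -/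
def IsRound (c : ι → K) : Prop := ∀ x, diagForm c x ≠ 0 → DiagIso (diagForm c x • c) c

theorem DiagIso.smul_mul {c : ι → K} {s t : K} (hs : DiagIso (s • c) c) (ht : DiagIso (t • c) c) :
    DiagIso ((s * t) • c) c := by
  rw [mul_smul]
  exact (ht.smul s).trans hs

/-- For nonzero values `s`, `t` of `c`, roundness of `c` gives `c ⊥ ac ≅ sc ⊥ atc ≅ (s + at)(c ⊥
a(st)c) ≅ (s + at)(c ⊥ ac)`, the middle step being the binary identity. A vanishing `s` or `t` is
treated separately. -/
theorem IsRound.dbl {c : ι → K} (h : IsRound c) (a : K) : IsRound (dbl a c) := by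
  intro z hz
  obtain ⟨x, y, hxy⟩ : ∃ x y : ι → K, diagForm (PfisterRam.dbl a c) z
      = diagForm c x + a * diagForm c y := by
    refine ⟨fun i => z (Sum.inl i), fun i => z (Sum.inr i), (diagForm_sumElim _ _ z).trans ?_⟩
    rw [diagForm_smul]
  rw [hxy] at hz ⊢
  set s := diagForm c x with hs
  set t := diagForm c y with ht
  rw [← dbl_smul]
  by_cases hs0 : s = 0
  · have ht0 : t ≠ 0 := by rintro h0; simp [hs0, h0] at hz
    have ha0 : a ≠ 0 := by rintro h0; simp [hs0, h0] at hz
    rw [hs0, zero_add, mul_smul, dbl_smul]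
    refine DiagIso.trans ?_ ((h y ht0).dbl a)
    refine diagIso_of_equiv_sq (Equiv.sumComm ι ι) (Sum.elim (fun _ => 1) fun _ => a)
      (by rintro (i | i) <;> simp [ha0]) ?_
    rintro (i | i) <;> simp [PfisterRam.dbl, ht]; ring
  by_cases ht0 : t = 0
  · rw [ht0, mul_zero, add_zero]
    exact (h x hs0).dbl a
  have h1 : DiagIso (PfisterRam.dbl a c) (Sum.elim (s • c) ((a * t) • c)) := by
    refine (h x hs0).symm.sumElim ?_
    rw [mul_smul]
    exact (h y ht0).symm.smul a
  refine (h1.trans ((sumElim_smul_smul_diagIso hz c).trans ?_)).symm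
  refine (DiagIso.refl _).sumElim ?_
  rw [show (s + a * t) * (s * (a * t)) = a * (s + a * t) * (s * t) by ring, mul_smul _ (s * t),
    smul_smul a]
  exact ((h x hs0).smul_mul (h y ht0)).smul _

/-- The symmetric bilinear form with diagonal Gram matrix. -/
def diagBilin (c : ι → K) : LinearMap.BilinForm K (ι → K) :=
  LinearMap.mk₂ K (fun x y => ∑ i, c i * (x i * y i))
    (fun x x' y => by simp [add_mul, mul_add, Finset.sum_add_distrib])
    (fun a x y => by simp [Finset.mul_sum]; exact Finset.sum_congr rfl fun i _ => by ring)
    (fun x y y' => by simp [mul_add, Finset.sum_add_distrib])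
    (fun a x y => by simp [Finset.mul_sum]; exact Finset.sum_congr rfl fun i _ => by ring)

theorem diagBilin_apply (c x y : ι → K) : diagBilin c x y = ∑ i, c i * (x i * y i) := rfl

theorem diagBilin_self (c x : ι → K) : diagBilin c x x = diagForm c x := (diagForm_apply c x).symm

theorem diagBilin_comm (c x y : ι → K) : diagBilin c x y = diagBilin c y x :=
  Finset.sum_congr rfl fun i _ => by rw [mul_comm (x i)]

theorem diagForm_add (c x y : ι → K) :
    diagForm c (x + y) = diagForm c x + diagForm c y + 2 * diagBilin c x y := by
  rw [← diagBilin_self, ← diagBilin_self, ← diagBilin_self, map_add, map_add, LinearMap.add_apply,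
    LinearMap.add_apply, diagBilin_comm c y x]
  ring

theorem associated_diagForm [Invertible (2 : K)] (c : ι → K) :
    QuadraticMap.associated (R := K) (diagForm c) = diagBilin c := by
  refine LinearMap.ext₂ fun x y => ?_
  have h := congrArg (fun B => B x y) (QuadraticMap.two_nsmul_associated K (diagForm c))
  refine mul_left_cancel₀ (Invertible.ne_zero (2 : K)) ?_
  simp only [LinearMap.smul_apply, QuadraticMap.polarBilin_apply_apply, QuadraticMap.polar,
    diagForm_add, nsmul_eq_mul, Nat.cast_ofNat] at h
  rw [h]
  ring

theorem diagBilin_single [DecidableEq ι] (c x : ι → K) (i : ι) (a : K) :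
    diagBilin c x (Pi.single i a) = c i * (x i * a) := by
  rw [diagBilin_apply, Finset.sum_eq_single i] <;> simp +contextual

theorem tmul_equivalent_diagForm [Invertible (2 : K)] {V : Type*} [AddCommGroup V] [Module K V]
    (a : ι → K) (δ : QuadraticForm K V) (w : Module.Basis κ K V)
    (hw : (QuadraticMap.associated (R := K) δ).IsOrthoᵢ w) :
    (QuadraticForm.tmul (diagForm a) δ).Equivalent
      (diagForm fun p : ι × κ => a p.1 * δ (w p.2)) := by
  classical
  let v := (Pi.basisFun K ι).tensorProduct w
  have h1 : (QuadraticMap.associated (R := K) (QuadraticForm.tmul (diagForm a) δ)).IsOrthoᵢ v := by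
    rintro ⟨i, j⟩ ⟨i', j'⟩ hne
    have h0 : QuadraticMap.associated (R := K) (QuadraticForm.tmul (diagForm a) δ)
        (v (i, j)) (v (i', j')) = QuadraticMap.associated (R := K) δ (w j) (w j') •
          diagBilin a (Pi.single i 1) (Pi.single i' 1) := by
      rw [QuadraticForm.associated_tmul, associated_diagForm, Module.Basis.tensorProduct_apply,
        Module.Basis.tensorProduct_apply, Pi.basisFun_apply, Pi.basisFun_apply]
      exact LinearMap.BilinForm.tensorDistrib_tmul _ _ _ _ _ _ _ _
    rw [Function.onFun, h0]
    by_cases hj : j = j'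
    · have hi : i' ≠ i := by rintro rfl; exact hne (by rw [hj])
      simp [diagBilin_single, hi]
    · have : QuadraticMap.associated (R := K) δ (w j) (w j') = 0 := hw hj
      rw [this, zero_smul]
  have h2 := QuadraticMap.basisRepr_eq_of_iIsOrtho _ v h1
  refine ⟨(QuadraticMap.isometryEquivBasisRepr _ v).trans ?_⟩
  rw [h2]
  refine QuadraticForm.weightedSumSquaresCongr ?_
  ext ⟨i, j⟩
  simp only [v, Module.Basis.tensorProduct_apply, QuadraticForm.tensorDistrib_tmul,
    Pi.basisFun_apply, smul_eq_mul]
  rw [← diagBilin_self, diagBilin_single]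
  simp [mul_comm]

theorem diagForm_mul_prod (c : ι → K) (b : κ → K) (x : ι × κ → K) :
    diagForm (fun p : ι × κ => c p.1 * b p.2) x
      = ∑ k, b k * diagForm c (fun i => x (i, k)) := by
  rw [diagForm_apply, Fintype.sum_prod_type_right]
  simp only [diagForm_apply, Finset.mul_sum]
  exact Finset.sum_congr rfl fun k _ => Finset.sum_congr rfl fun i _ => by ring

theorem DiagIso.mul_prod {a : ι → K} {a' : ι' → K} (h : DiagIso a a') (b : κ → K) :
    DiagIso (fun p : ι × κ => a p.1 * b p.2) fun p : ι' × κ => a' p.1 * b p.2 := by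
  obtain ⟨f⟩ := h
  let g : (ι × κ → K) ≃ₗ[K] (ι' × κ → K) :=
    { toFun := fun x p => f (fun i => x (i, p.2)) p.1
      invFun := fun x p => f.symm (fun i => x (i, p.2)) p.1
      map_add' := fun x y => by
        ext p
        exact congrFun (map_add f (fun i => x (i, p.2)) fun i => y (i, p.2)) p.1
      map_smul' := fun r x => by
        ext p
        exact congrFun (map_smul f r fun i => x (i, p.2)) p.1
      left_inv := fun x => by
        ext p
        exact congrFun (f.symm_apply_apply fun i => x (i, p.2)) p.1
      right_inv := fun x => by
        ext p
        exact congrFun (f.apply_symm_apply fun i => x (i, p.2)) p.1 }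
  refine diagIso_of_linearEquiv g fun x => ?_
  rw [diagForm_mul_prod, diagForm_mul_prod]
  exact Finset.sum_congr rfl fun k _ => congrArg (b k * ·) (f.map_app fun i => x (i, k))

/-- A diagonal form divides `φ` only if `φ` is diagonalized by products of its entries with
the entries of another diagonal form. -/
theorem Divides.exists_diagForm [Invertible (2 : K)] {V : Type*} [AddCommGroup V] [Module K V]
    {φ : QuadraticForm K V} {a : ι → K} (h : Divides (diagForm a) φ) :
    ∃ (n : ℕ) (b : Fin n → K), φ.Equivalent (diagForm fun p : ι × Fin n => a p.1 * b p.2) := by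
  obtain ⟨n, δ, h⟩ := h
  obtain ⟨w, hw⟩ := LinearMap.BilinForm.exists_orthogonal_basis
    (QuadraticForm.associated_isSymm K δ)
  exact ⟨_, fun j => δ (w j), h.trans (tmul_equivalent_diagForm a δ w hw)⟩

theorem divides_of_equivalent_dbl [Invertible (2 : K)] {V : Type*} [AddCommGroup V] [Module K V]
    {φ : QuadraticForm K V} {a : ι → K} {x : K} (h : φ.Equivalent (diagForm (dbl x a))) :
    Divides (diagForm a) φ := by
  classical
  refine ⟨2, diagForm ![1, x], h.trans (QuadraticMap.Equivalent.trans ?_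
    (tmul_equivalent_diagForm a _ (Pi.basisFun K (Fin 2)) ?_).symm)⟩
  · refine DiagIso.symm (diagIso_of_equiv
      ((Equiv.prodComm _ _).trans ((finTwoEquiv.prodCongr (Equiv.refl ι)).trans
        (Equiv.boolProdEquivSum ι))) ?_)
    rintro ⟨i, j⟩
    rw [← diagBilin_self, Pi.basisFun_apply, diagBilin_single]
    fin_cases j <;> simp [Equiv.boolProdEquivSum, dbl, finTwoEquiv, mul_comm]
  · intro i j hij
    rw [Function.onFun, associated_diagForm]
    simp [diagBilin_single, hij.symm]

theorem DiagIso.exists_linearEquiv {c : ι → K} {c' : κ → K} (h2 : (2 : K) ≠ 0)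
    (h : DiagIso c c') :
    ∃ f : (ι → K) ≃ₗ[K] (κ → K), ∀ x y, diagBilin c' (f x) (f y) = diagBilin c x y := by
  obtain ⟨f⟩ := h
  refine ⟨f.toLinearEquiv, fun x y => mul_left_cancel₀ h2 ?_⟩
  have h := f.map_app (x + y)
  rw [diagForm_add, map_add, diagForm_add, f.map_app, f.map_app] at h
  exact add_left_cancel h

/-- A zero entry would put a basis vector into the radical. This makes the entries of a cofactor of
a Pfister form nonzero. -/
theorem DiagIso.ne_zero {c : ι → K} {c' : κ → K} (h2 : (2 : K) ≠ 0) (h : DiagIso c c')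
    (hc : ∀ i, c i ≠ 0) (j : κ) : c' j ≠ 0 := by
  classical
  intro hj
  obtain ⟨f, hf⟩ := h.exists_linearEquiv h2
  have h0 : ∀ x, diagBilin c x (f.symm (Pi.single j 1)) = 0 := fun x => by
    rw [← hf, LinearEquiv.apply_symm_apply, diagBilin_single, hj, zero_mul]
  have h1 : f.symm (Pi.single j 1) = 0 := by
    ext i
    have := h0 (Pi.single i 1)
    rw [diagBilin_comm, diagBilin_single, mul_one] at this
    exact (mul_eq_zero.1 this).resolve_left (hc i)
  rw [LinearEquiv.map_eq_zero_iff] at h1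
  simpa using congrFun h1 j

end Diagonal
end PfisterRam

namespace PfisterRam

/-! ### Metabolic forms and Witt equivalence. -/

section Lagrangian

variable {K ι κ : Type*} [Field K] [Fintype ι] [Fintype κ]

/-- `M` is its own orthogonal complement with respect to the diagonal form `c`. -/
def IsLagrangian (c : ι → K) (M : Submodule K (ι → K)) : Prop :=
  ∀ x, x ∈ M ↔ ∀ y ∈ M, diagBilin c x y = 0

/-- The diagonal form `c` is anisotropic. -/
def IsAniso (c : ι → K) : Prop := ∀ x, diagForm c x = 0 → x = 0

theorem isRefl_diagBilin (c : ι → K) : (diagBilin c).IsRefl :=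
  fun x y h => by rw [diagBilin_comm, h]

theorem nondegenerate_diagBilin {c : ι → K} (hc : ∀ i, c i ≠ 0) : (diagBilin c).Nondegenerate := by
  classical
  have h : ∀ x, (∀ y, diagBilin c x y = 0) → x = 0 := fun x hx => by
    ext i
    have := hx (Pi.single i 1)
    rw [diagBilin_single, mul_one] at this
    exact (mul_eq_zero.1 this).resolve_left (hc i)
  exact ⟨h, fun y hy => h y fun x => by rw [diagBilin_comm, hy]⟩

theorem IsLagrangian.orthogonal_eq {c : ι → K} {M : Submodule K (ι → K)} (h : IsLagrangian c M) :
    (diagBilin c).orthogonal M = M := by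
  ext x
  rw [h x, LinearMap.BilinForm.mem_orthogonal_iff]
  refine forall₂_congr fun y _ => ?_
  rw [diagBilin_comm]

theorem IsLagrangian.finrank_add_self {c : ι → K} {M : Submodule K (ι → K)} (hc : ∀ i, c i ≠ 0)
    (h : IsLagrangian c M) : Module.finrank K M + Module.finrank K M = Fintype.card ι := by
  have h1 := LinearMap.BilinForm.finrank_orthogonal (nondegenerate_diagBilin hc) M
  have h2 := Submodule.finrank_le M
  rw [h.orthogonal_eq] at h1
  rw [Module.finrank_fintype_fun_eq_card] at h1 h2
  omega

theorem diagBilin_sumElim (a : ι → K) (b : κ → K) (x y : ι ⊕ κ → K) :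
    diagBilin (Sum.elim a b) x y
      = diagBilin a (x ∘ Sum.inl) (y ∘ Sum.inl) + diagBilin b (x ∘ Sum.inr) (y ∘ Sum.inr) := by
  simp [diagBilin_apply]

theorem diagBilin_neg (c x y : ι → K) : diagBilin (-c) x y = -diagBilin c x y := by
  simp [diagBilin_apply]

/-- If `c ⊥ -c'` and `c'` are metabolic, then so is `c`. -/
theorem IsLagrangian.reduction {c : ι → K} {c' : κ → K} (hc : ∀ i, c i ≠ 0) (hc' : ∀ i, c' i ≠ 0)
    {M : Submodule K (ι ⊕ κ → K)} {M' : Submodule K (κ → K)}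
    (hM : IsLagrangian (Sum.elim c (-c')) M) (hM' : IsLagrangian c' M') :
    ∃ N, IsLagrangian c N := by
  let D : Submodule K (ι ⊕ κ → K) :=
    { carrier := {p | p ∘ Sum.inl = 0 ∧ p ∘ Sum.inr ∈ M'}
      add_mem' := fun {p q} hp hq =>
        ⟨by rw [Pi.add_comp, hp.1, hq.1, add_zero], M'.add_mem hp.2 hq.2⟩
      zero_mem' := ⟨rfl, M'.zero_mem⟩
      smul_mem' := fun a p hp => ⟨by rw [Pi.smul_comp, hp.1, smul_zero], M'.smul_mem a hp.2⟩ }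
  have hB : (diagBilin (Sum.elim c (-c'))).Nondegenerate :=
    nondegenerate_diagBilin (by rintro (i | i) <;> simp [hc, hc'])
  let N : Submodule K (ι → K) :=
    { carrier := {y | ∃ z ∈ M', Sum.elim y z ∈ M}
      add_mem' := by
        rintro y y' ⟨z, hz, h⟩ ⟨z', hz', h'⟩
        exact ⟨z + z', M'.add_mem hz hz', by
          convert M.add_mem h h' using 1
          ext (i | i) <;> rfl⟩
      zero_mem' := ⟨0, M'.zero_mem, by rw [Sum.elim_zero_zero]; exact M.zero_mem⟩
      smul_mem' := by
        rintro a y ⟨z, hz, h⟩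
        exact ⟨a • z, M'.smul_mem a hz, by
          convert M.smul_mem a h using 1
          ext (i | i) <;> rfl⟩ }
  refine ⟨N, fun y => ⟨?_, fun hy => ?_⟩⟩
  · rintro ⟨z, hz, h⟩ y' ⟨z', hz', h'⟩
    have h1 := (hM _).1 h _ h'
    rw [diagBilin_sumElim, diagBilin_neg] at h1
    simp only [Sum.elim_comp_inl, Sum.elim_comp_inr] at h1
    rwa [(hM' z).1 hz z' hz', neg_zero, add_zero] at h1
  -- The orthogonal complement of `M + D` is `M ∩ Dᗮ`, and its vectors have first component in `N`.
  -- So `y ⟂ N` makes `(y, 0)` orthogonal to it, and the double orthogonal puts `(y, 0)` in `M + D`.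
  · have h1 : Sum.elim y 0 ∈ (diagBilin (Sum.elim c (-c'))).orthogonal
        ((diagBilin (Sum.elim c (-c'))).orthogonal (M ⊔ D)) := by
      rw [LinearMap.BilinForm.mem_orthogonal_iff]
      intro p hp
      rw [LinearMap.BilinForm.mem_orthogonal_iff] at hp
      have hpM : p ∈ M := (hM p).2 fun q hq => by
        rw [diagBilin_comm]; exact hp q (Submodule.mem_sup_left hq)
      have hpM' : p ∘ Sum.inr ∈ M' := (hM' _).2 fun q hq => by
        have := hp (Sum.elim 0 q) (Submodule.mem_sup_right ⟨rfl, hq⟩)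
        rw [diagBilin_sumElim, diagBilin_neg] at this
        simp only [Sum.elim_comp_inl, Sum.elim_comp_inr, map_zero, LinearMap.zero_apply,
          zero_add, neg_eq_zero] at this
        rw [diagBilin_comm, this]
      rw [diagBilin_sumElim]
      simp only [Sum.elim_comp_inl, Sum.elim_comp_inr, map_zero, add_zero]
      rw [diagBilin_comm]
      exact hy _ ⟨_, hpM', by rwa [Sum.elim_comp_inl_inr]⟩
    rw [LinearMap.BilinForm.orthogonal_orthogonal hB (isRefl_diagBilin _)] at h1
    obtain ⟨m, hm, p, ⟨hp1, hp2⟩, hmp⟩ := Submodule.mem_sup.1 h1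
    refine ⟨-(p ∘ Sum.inr), M'.neg_mem hp2, ?_⟩
    convert hm
    ext (i | i)
    · have := congrFun hmp (Sum.inl i)
      have h0 : p (Sum.inl i) = 0 := congrFun hp1 i
      simpa [h0] using this.symm
    · have := congrFun hmp (Sum.inr i)
      simp only [Pi.add_apply, Sum.elim_inr, Pi.zero_apply] at this
      simp only [Sum.elim_inr, Pi.neg_apply, Function.comp_apply]
      linear_combination -this

theorem isLagrangian_diagonal {c : ι → K} (hc : ∀ i, c i ≠ 0) :
    ∃ M, IsLagrangian (Sum.elim c (-c)) M := by
  refine ⟨{ carrier := {p | p ∘ Sum.inl = p ∘ Sum.inr}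
            add_mem' := fun {p q} hp hq => by
              rw [Set.mem_ofPred_eq, Pi.add_comp, Pi.add_comp, hp, hq]
            zero_mem' := rfl
            smul_mem' := fun a p hp => by
              rw [Set.mem_ofPred_eq, Pi.smul_comp, Pi.smul_comp, hp] }, fun x => ⟨?_, fun h => ?_⟩⟩
  · intro hx y hy
    replace hx : x ∘ Sum.inl = x ∘ Sum.inr := hx
    replace hy : y ∘ Sum.inl = y ∘ Sum.inr := hy
    rw [diagBilin_sumElim, diagBilin_neg, hx, hy, add_neg_cancel]
  · refine sub_eq_zero.1 ((nondegenerate_diagBilin hc).1 _ fun y => ?_)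
    have := h (Sum.elim y y) rfl
    rw [diagBilin_sumElim, diagBilin_neg] at this
    simp only [Sum.elim_comp_inl, Sum.elim_comp_inr] at this
    rw [map_sub, LinearMap.sub_apply]
    linear_combination this

/-- The form pairs `M` perfectly with a complement `N`, so `M` is the dual of `N`. Subtracting half
of the form on `N`, viewed in `M`, makes the embedded copy of `N` totally isotropic. -/
theorem IsLagrangian.isHyperbolic {c : ι → K} (h2 : (2 : K) ≠ 0) (hc : ∀ i, c i ≠ 0)
    {M : Submodule K (ι → K)} (hM : IsLagrangian c M) : IsHyperbolic (diagForm c) := by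
  obtain ⟨N, hN⟩ := Submodule.exists_isCompl M
  have hfin := hM.finrank_add_self hc
  have hfin' := Submodule.finrank_add_eq_of_isCompl hN
  rw [Module.finrank_fintype_fun_eq_card] at hfin'
  let g : M →ₗ[K] Module.Dual K N := ((diagBilin c).compl₂ N.subtype).comp M.subtype
  have hg : ∀ m n, g m n = diagBilin c m n := fun _ _ => rfl
  have hginj : Function.Injective g := by
    rw [injective_iff_map_eq_zero]
    intro m hm
    refine Subtype.ext ((nondegenerate_diagBilin hc).1 _ fun y => ?_)
    obtain ⟨m', hm', n, hn, rfl⟩ :=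
      Submodule.mem_sup.1 (show y ∈ M ⊔ N by rw [hN.sup_eq_top]; trivial)
    rw [map_add, (hM m).1 m.2 _ hm', zero_add]
    exact LinearMap.congr_fun hm ⟨n, hn⟩
  let e : M ≃ₗ[K] Module.Dual K N := LinearEquiv.ofInjectiveOfFinrankEq g hginj
    (by rw [Subspace.dual_finrank_eq]; omega)
  have he : ∀ f (n : N), diagBilin c (e.symm f) n = f n := fun f n => by
    rw [← hg]
    exact LinearMap.congr_fun (e.apply_symm_apply f) n
  let b : N →ₗ[K] Module.Dual K N := ((diagBilin c).compl₂ N.subtype).comp N.subtype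
  have hb : ∀ m n, b m n = diagBilin c m n := fun _ _ => rfl
  let Φ : Module.Dual K N × N →ₗ[K] (ι → K) :=
    (M.subtype.comp (e.symm.toLinearMap.comp
      ((2⁻¹ : K) • (LinearMap.fst K _ _ - b.comp (LinearMap.snd K _ _))))) +
      N.subtype.comp (LinearMap.snd K _ _)
  have hΦ : ∀ p, Φ p = (e.symm ((2⁻¹ : K) • (p.1 - b p.2)) : ι → K) + p.2 := fun _ => rfl
  have hq : ∀ p, diagForm c (Φ p) = QuadraticForm.dualProd K N p := fun p => by
    rw [hΦ, diagForm_add, ← diagBilin_self, ← diagBilin_self, (hM _).1 (Subtype.mem _) _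
      (Subtype.mem _), he, LinearMap.smul_apply, LinearMap.sub_apply, hb, smul_eq_mul,
      QuadraticForm.dualProd_apply]
    field_simp
    ring
  have hΦinj : Function.Injective Φ := by
    rw [injective_iff_map_eq_zero]
    rintro ⟨f, n⟩ hfn
    rw [hΦ] at hfn
    have hn : (n : ι → K) ∈ M := by
      rw [eq_neg_of_add_eq_zero_right hfn]
      exact M.neg_mem (Subtype.mem _)
    have hn0 : n = 0 := Subtype.ext (Submodule.disjoint_def.1 hN.disjoint _ hn n.2)
    subst hn0
    simpa [h2] using hfn
  let Ψ := LinearEquiv.ofInjectiveOfFinrankEq Φ hΦinj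
    (by rw [Module.finrank_prod, Subspace.dual_finrank_eq, Module.finrank_fintype_fun_eq_card]
        omega)
  refine ⟨Module.finrank K N, ?_⟩
  have h3 : (QuadraticForm.dualProd K N).Equivalent (diagForm c) := ⟨⟨Ψ, hq⟩⟩
  exact h3.symm.trans ⟨QuadraticForm.dualProdIsometry (Module.finBasis K N).equivFun⟩

theorem not_isAniso_of_isHyperbolic [Nonempty ι] {c : ι → K} (h : IsHyperbolic (diagForm c)) :
    ¬ IsAniso c := by
  classical
  intro ha
  obtain ⟨n, ⟨f⟩⟩ := h
  have h0 : ∀ x : Fin n → K, x = 0 := fun x => by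
    have h1 : f.symm (0, x) = 0 := ha _ (by rw [f.symm.map_app]; rfl)
    have h2 := congrArg f h1
    rw [f.apply_symm_apply, map_zero] at h2
    exact congrArg Prod.snd h2
  have h1 : ∀ x : ι → K, x = 0 := fun x => by
    have h3 : f x = 0 := by
      refine Prod.ext (LinearMap.ext fun y => ?_) (h0 _)
      rw [h0 y, map_zero, map_zero]
    rw [← f.symm_apply_apply x, h3, map_zero]
  obtain ⟨i⟩ := ‹Nonempty ι›
  simpa using congrFun (h1 (Pi.single i 1)) i

/-- Such a `p` is an isotropic vector of `c'`. Hence the projection of `M` to the first summand is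
injective, which drives the next two results. -/
theorem IsLagrangian.eq_zero_of_isAniso {c : ι → K} {c' : κ → K} (hc' : IsAniso c')
    {M : Submodule K (ι ⊕ κ → K)} (hM : IsLagrangian (Sum.elim c (-c')) M) {p : ι ⊕ κ → K}
    (hp : p ∈ M) (h : p ∘ Sum.inl = 0) : p = 0 := by
  have h1 := (hM p).1 hp p hp
  rw [diagBilin_sumElim, h, map_zero, zero_add, diagBilin_neg, neg_eq_zero, diagBilin_self] at h1
  rw [← Sum.elim_comp_inl_inr p, h, hc' _ h1, Sum.elim_zero_zero]

theorem IsLagrangian.card_le {c : ι → K} {c' : κ → K} (hc : ∀ i, c i ≠ 0) (hc' : ∀ i, c' i ≠ 0)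
    (ha : IsAniso c') {M : Submodule K (ι ⊕ κ → K)} (hM : IsLagrangian (Sum.elim c (-c')) M) :
    Fintype.card κ ≤ Fintype.card ι := by
  have h1 := hM.finrank_add_self (by rintro (i | i) <;> simp [hc, hc'])
  let g : M →ₗ[K] (ι → K) := (LinearMap.funLeft K K Sum.inl).comp M.subtype
  have hg : Function.Injective g := by
    rw [injective_iff_map_eq_zero]
    exact fun p hp => Subtype.ext (hM.eq_zero_of_isAniso ha p.2 hp)
  have h2 := LinearMap.finrank_le_finrank_of_injective hg
  rw [Module.finrank_fintype_fun_eq_card] at h2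
  rw [Fintype.card_sum] at h1
  omega

/-- In equal dimensions the injective projection is bijective, so `M` is the graph of a linear map,
and total isotropy of `M` makes that map an isometry. -/
theorem IsLagrangian.diagIso {c : ι → K} {c' : κ → K} (hc : ∀ i, c i ≠ 0) (hc' : ∀ i, c' i ≠ 0)
    (ha : IsAniso c') (hcard : Fintype.card κ = Fintype.card ι) {M : Submodule K (ι ⊕ κ → K)}
    (hM : IsLagrangian (Sum.elim c (-c')) M) : DiagIso c c' := by
  have h1 := hM.finrank_add_self (by rintro (i | i) <;> simp [hc, hc'])
  rw [Fintype.card_sum] at h1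
  let g : M →ₗ[K] (ι → K) := (LinearMap.funLeft K K Sum.inl).comp M.subtype
  have hg : Function.Injective g := by
    rw [injective_iff_map_eq_zero]
    exact fun p hp => Subtype.ext (hM.eq_zero_of_isAniso ha p.2 hp)
  let e : M ≃ₗ[K] (ι → K) := LinearEquiv.ofInjectiveOfFinrankEq g hg
    (by rw [Module.finrank_fintype_fun_eq_card]; omega)
  let f : (ι → K) →ₗ[K] (κ → K) :=
    ((LinearMap.funLeft K K Sum.inr).comp M.subtype).comp e.symm.toLinearMap
  have hf : ∀ x y, diagBilin c' (f x) (f y) = diagBilin c x y := fun x y => by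
    have h3 := (hM _).1 (e.symm x).2 _ (e.symm y).2
    rw [diagBilin_sumElim, diagBilin_neg] at h3
    have hx : (e.symm x : ι ⊕ κ → K) ∘ Sum.inl = x := e.apply_symm_apply x
    have hy : (e.symm y : ι ⊕ κ → K) ∘ Sum.inl = y := e.apply_symm_apply y
    rw [hx, hy] at h3
    have h4 : diagBilin c' (f x) (f y) = diagBilin c'
      ((e.symm x : ι ⊕ κ → K) ∘ Sum.inr) ((e.symm y : ι ⊕ κ → K) ∘ Sum.inr) := rfl
    rw [h4]
    linear_combination -h3
  have hfinj : Function.Injective f := by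
    rw [injective_iff_map_eq_zero]
    intro x hx
    refine (nondegenerate_diagBilin hc).1 _ fun y => ?_
    rw [← hf, hx, map_zero, LinearMap.zero_apply]
  refine diagIso_of_linearEquiv (LinearEquiv.ofInjectiveOfFinrankEq f hfinj (by simp [hcard]))
    fun x => ?_
  rw [← diagBilin_self, ← diagBilin_self]
  exact hf x x

end Lagrangian
end PfisterRam

namespace PfisterRam

/-! ### Reduction of Lagrangians modulo a uniformizer. -/

section Lattice

variable {R F ι κ : Type*} [CommRing R] [IsDomain R] [IsPrincipalIdealRing R] [IsLocalRing R]
  [Field F] [Algebra R F] [IsFractionRing R F] [Fintype ι] [Fintype κ]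

/-- A Lagrangian of `⟨u⟩ ⊥ ϖ⟨w⟩` over the fraction field of a discrete valuation ring induces a
Lagrangian of the second residue form. -/
theorem IsLagrangian.exists_residue {ϖ : R} (hϖ0 : ϖ ≠ 0)
    (hϖ : IsLocalRing.maximalIdeal R = Ideal.span {ϖ}) (u : ι → Rˣ) (w : κ → Rˣ)
    {U : Submodule F (ι ⊕ κ → F)}
    (hU : IsLagrangian (Sum.elim (fun i => algebraMap R F (u i))
      fun j => algebraMap R F ϖ * algebraMap R F (w j)) U) :
    ∃ M, IsLagrangian (fun j => IsLocalRing.residue R (w j)) M := by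
  classical
  set φ := algebraMap R F with hφ
  set c : ι ⊕ κ → F := Sum.elim (fun i => φ (u i)) fun j => φ ϖ * φ (w j) with hc
  have hφϖ : φ ϖ ≠ 0 := by simpa [hφ] using hϖ0
  -- The lattice is `R^ι ⊕ ϖ⁻¹R^κ`. On it `ϖ` times the form is integral, equal to `ϖ⟨u⟩ ⊥ ⟨w⟩`, and
  -- reduces to the second residue form.
  let s : ι ⊕ κ → F := Sum.elim (fun _ => 1) fun _ => (φ ϖ)⁻¹
  have hs : ∀ i, s i ≠ 0 := by rintro (i | i) <;> simp [s, hφϖ]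
  let emb : (ι ⊕ κ → R) → ι ⊕ κ → F := fun x i => s i * φ (x i)
  let A : (ι ⊕ κ → R) → (ι ⊕ κ → R) → R := fun x y =>
    ∑ i, (u i : R) * (x (Sum.inl i) * y (Sum.inl i))
  let W : (κ → R) → (ι ⊕ κ → R) →ₗ[R] R := fun z =>
    ∑ j, ((w j : R) * z j) • LinearMap.proj (Sum.inr j)
  have hW : ∀ z y, W z y = ∑ j, (w j : R) * (z j * y (Sum.inr j)) := fun z y => by
    simp [W, mul_assoc]
  have hemb : ∀ x y, φ ϖ * diagBilin c (emb x) (emb y) = φ (ϖ * A x y + W (x ∘ Sum.inr) y) := by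
    intro x y
    rw [hW, diagBilin_apply, Fintype.sum_sum_type]
    simp only [emb, s, c, Sum.elim_inl, Sum.elim_inr, A, map_add, map_mul, map_sum, mul_add,
      Finset.mul_sum, Function.comp_apply]
    refine congrArg₂ _ (Finset.sum_congr rfl fun i _ => by ring)
      (Finset.sum_congr rfl fun i _ => by field_simp)
  have hemb0 : ∀ x y, diagBilin c (emb x) (emb y) = 0 ↔ ϖ * A x y + W (x ∘ Sum.inr) y = 0 := by
    intro x y
    rw [← map_eq_zero_iff φ (IsFractionRing.injective R F), ← hemb, mul_eq_zero,
      or_iff_right hφϖ]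
  let S : Submodule R (ι ⊕ κ → R) :=
    { carrier := {x | emb x ∈ U}
      add_mem' := fun {x y} hx hy => by
        have : emb (x + y) = emb x + emb y := by ext i; simp [emb, mul_add]
        exact (congrArg (· ∈ U) this).mpr (U.add_mem hx hy)
      zero_mem' := by
        have : emb 0 = 0 := by ext i; simp [emb]
        exact (congrArg (· ∈ U) this).mpr U.zero_mem
      smul_mem' := fun a x hx => by
        have : emb (a • x) = φ a • emb x := by
          ext i; simp only [emb, Pi.smul_apply, smul_eq_mul, map_mul]; ring
        exact (congrArg (· ∈ U) this).mpr (U.smul_mem _ hx) }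
  have hS : ∀ x, x ∈ S ↔ emb x ∈ U := fun _ => Iff.rfl
  have hSU : ∀ y ∈ U, ∃ r : R, r ≠ 0 ∧ ∃ x ∈ S, emb x = φ r • y := by
    intro y hy
    obtain ⟨b, hb⟩ := IsLocalization.exist_integer_multiples_of_finite (nonZeroDivisors R)
      (fun i => (s i)⁻¹ * y i)
    choose x hx using hb
    have hxe : emb x = φ b • y := by
      ext i
      simp only [emb, hφ, hx, Pi.smul_apply, smul_eq_mul]
      rw [Algebra.smul_def, mul_left_comm, mul_inv_cancel_left₀ (hs i)]
    exact ⟨b, nonZeroDivisors.coe_ne_zero b, x, by rw [hS, hxe]; exact U.smul_mem _ hy, hxe⟩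
  have hSS : ∀ x, x ∈ S ↔ ∀ y ∈ S, ϖ * A x y + W (x ∘ Sum.inr) y = 0 := by
    intro x
    rw [hS, hU]
    refine ⟨fun h y hy => (hemb0 x y).1 (h _ hy), fun h y hy => ?_⟩
    obtain ⟨r, hr, x', hx', hxy⟩ := hSU y hy
    have h1 := (hemb0 x x').2 (h x' hx')
    rw [hxy, map_smul, smul_eq_mul, mul_eq_zero] at h1
    exact h1.resolve_left (by simpa [hφ] using hr)
  -- A torsion-free finite quotient is free, so `S` is a direct summand of the lattice, with
  -- projection `ρ`.
  have htf : Module.IsTorsionFree R ((ι ⊕ κ → R) ⧸ S) := by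
    refine ⟨fun r hr => ?_⟩
    rw [isSMulRegular_iff_right_eq_zero_of_smul]
    intro q hq
    obtain ⟨x, rfl⟩ := Submodule.Quotient.mk_surjective S q
    rw [← Submodule.Quotient.mk_smul, Submodule.Quotient.mk_eq_zero, hSS] at hq
    rw [Submodule.Quotient.mk_eq_zero, hSS]
    intro y hy
    have h1 := hq y hy
    have h2 : ϖ * A (r • x) y + W ((r • x) ∘ Sum.inr) y = r * (ϖ * A x y + W (x ∘ Sum.inr) y) := by
      simp only [hW, A, Pi.smul_apply, smul_eq_mul, Function.comp_apply, mul_add, Finset.mul_sum]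
      refine congrArg₂ _ (Finset.sum_congr rfl fun i _ => by ring)
        (Finset.sum_congr rfl fun i _ => by ring)
    rw [h2, mul_eq_zero] at h1
    exact h1.resolve_left hr.ne_zero
  have : Module.Free R ((ι ⊕ κ → R) ⧸ S) := Module.free_of_finite_type_torsion_free'
  obtain ⟨g, hg⟩ := LinearMap.exists_rightInverse_of_surjective S.mkQ S.range_mkQ
  let ρ : (ι ⊕ κ → R) →ₗ[R] (ι ⊕ κ → R) := LinearMap.id - g.comp S.mkQ
  have hρS : ∀ x, ρ x ∈ S := fun x => by
    rw [← S.ker_mkQ, LinearMap.mem_ker]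
    have := LinearMap.congr_fun hg (S.mkQ x)
    simp only [LinearMap.comp_apply, LinearMap.id_apply] at this
    change S.mkQ (x - g (S.mkQ x)) = 0
    rw [map_sub, this, sub_self]
  have hρ : ∀ x ∈ S, ρ x = x := fun x hx => by
    rw [← S.ker_mkQ, LinearMap.mem_ker] at hx
    simp [ρ, hx]
  let res := IsLocalRing.residue R
  have hres : ∀ r, res r = 0 ↔ ϖ ∣ r := fun r => by
    rw [IsLocalRing.residue_eq_zero_iff, hϖ, Ideal.mem_span_singleton]
  have hresW : ∀ (z : κ → R) y, res (W z y) =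
      diagBilin (fun j => res (w j)) (res ∘ z) (res ∘ y ∘ Sum.inr) := fun z y => by
    rw [hW, diagBilin_apply, map_sum]
    simp
  let M : Submodule (IsLocalRing.ResidueField R) (κ → IsLocalRing.ResidueField R) :=
    { carrier := {z | ∃ x ∈ S, res ∘ x ∘ Sum.inr = z}
      add_mem' := by
        rintro z z' ⟨x, hx, rfl⟩ ⟨x', hx', rfl⟩
        exact ⟨x + x', S.add_mem hx hx', by ext j; simp⟩
      zero_mem' := ⟨0, S.zero_mem, by ext j; simp⟩
      smul_mem' := by
        rintro a z ⟨x, hx, rfl⟩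
        obtain ⟨a, rfl⟩ := IsLocalRing.residue_surjective a
        exact ⟨a • x, S.smul_mem a hx, by ext j; simp [res]⟩ }
  refine ⟨M, fun z => ⟨?_, fun hz => ?_⟩⟩
  · rintro ⟨x, hx, rfl⟩ _ ⟨y, hy, rfl⟩
    rw [← hresW, hres]
    exact ⟨-A x y, by linear_combination (hSS x).1 hx y hy⟩
  · obtain ⟨z, rfl⟩ : ∃ z' : κ → R, res ∘ z' = z :=
      ⟨_, funext fun j => (IsLocalRing.residue_surjective (z j)).choose_spec⟩
    have hdvd : ∀ x ∈ S, ϖ ∣ W z x := fun x hx => by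
      rw [← hres, hresW]
      exact hz _ ⟨x, hx, rfl⟩
    -- On `S` the functional `W z` is divisible by `ϖ`; composing with `ρ` extends the quotient to
    -- the whole lattice, with coefficients `p`.
    choose p hp using fun i => hdvd _ (hρS (Pi.single i 1))
    have hWp : ∀ x ∈ S, W z x = ϖ * ∑ i, p i * x i := by
      intro x hx
      conv_lhs => rw [← hρ x hx, pi_eq_sum_univ' x]
      simp only [map_sum, map_smul, smul_eq_mul, Finset.mul_sum]
      refine Finset.sum_congr rfl fun i _ => ?_
      rw [hp]
      ring
    -- The correction of `z` for which pairing with `t` is `W z - ϖp`, hence zero on `S`. Its second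
    -- component is still `z` modulo `ϖ`.
    let t : ι ⊕ κ → R := Sum.elim (fun i => -(↑(u i)⁻¹ * p (Sum.inl i)))
      fun j => z j - ϖ * (↑(w j)⁻¹ * p (Sum.inr j))
    refine ⟨t, (hSS t).2 fun x hx => ?_, ?_⟩
    · have h1 := hWp x hx
      rw [hW, Fintype.sum_sum_type] at h1
      have h2 : A t x = -∑ i, p (Sum.inl i) * x (Sum.inl i) := by
        simp only [A, t, Sum.elim_inl]
        rw [← Finset.sum_neg_distrib]
        refine Finset.sum_congr rfl fun i _ => ?_
        linear_combination (-p (Sum.inl i) * x (Sum.inl i)) * (u i).mul_inv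
      have h3 : W (t ∘ Sum.inr) x = ∑ j, (w j : R) * (z j * x (Sum.inr j))
          - ϖ * ∑ j, p (Sum.inr j) * x (Sum.inr j) := by
        rw [hW, Finset.mul_sum, ← Finset.sum_sub_distrib]
        refine Finset.sum_congr rfl fun j _ => ?_
        simp only [t, Function.comp_apply, Sum.elim_inr]
        linear_combination (-ϖ * p (Sum.inr j) * x (Sum.inr j)) * (w j).mul_inv
      rw [h2, h3, h1]
      ring
    · ext j
      have : res ϖ = 0 := (hres ϖ).2 dvd_rfl
      simp [t, this]

end Lattice

/-! ### Lagrangians from isometries. -/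

section Graph

variable {F ι κ ι' κ' : Type*} [Field F] [Fintype ι] [Fintype κ] [Fintype ι'] [Fintype κ']

/-- The graph of an isometry between diagonal forms is a Lagrangian of their difference. -/
theorem DiagIso.exists_isLagrangian {c : ι → F} {c' : κ → F} (h2 : (2 : F) ≠ 0)
    (hc : ∀ i, c i ≠ 0) (h : DiagIso c c') : ∃ U, IsLagrangian (Sum.elim c (-c')) U := by
  obtain ⟨f, hf⟩ := h.exists_linearEquiv h2
  refine ⟨LinearMap.eqLocus (f.toLinearMap.comp (LinearMap.funLeft F F Sum.inl))
    (LinearMap.funLeft F F Sum.inr), fun x => ⟨fun hx y hy => ?_, fun h => ?_⟩⟩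
  · replace hx : f (x ∘ Sum.inl) = x ∘ Sum.inr := hx
    replace hy : f (y ∘ Sum.inl) = y ∘ Sum.inr := hy
    rw [diagBilin_sumElim, diagBilin_neg, ← hx, ← hy, hf, add_neg_cancel]
  · have h1 : x ∘ Sum.inl = f.symm (x ∘ Sum.inr) := by
      refine sub_eq_zero.1 ((nondegenerate_diagBilin hc).1 _ fun y => ?_)
      have := h (Sum.elim y (f y)) rfl
      rw [diagBilin_sumElim, diagBilin_neg] at this
      simp only [Sum.elim_comp_inl, Sum.elim_comp_inr] at this
      rw [map_sub, LinearMap.sub_apply, ← hf (f.symm _), f.apply_symm_apply]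
      linear_combination this
    change f (x ∘ Sum.inl) = x ∘ Sum.inr
    rw [h1, f.apply_symm_apply]

theorem IsLagrangian.reindex {c : ι → F} {c' : κ → F} (e : ι ≃ κ) (h : ∀ i, c i = c' (e i))
    {U : Submodule F (ι → F)} (hU : IsLagrangian c U) : ∃ U', IsLagrangian c' U' := by
  let L := LinearEquiv.funCongrLeft F F e
  have hL : ∀ x y, diagBilin c (L x) (L y) = diagBilin c' x y := fun x y =>
    Fintype.sum_equiv e _ _ fun i => by rw [h]; rfl
  refine ⟨U.comap L.toLinearMap, fun x => ?_⟩
  rw [Submodule.mem_comap, hU]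
  refine ⟨fun hx y hy => by rw [← hL]; exact hx _ hy, fun hx y hy => ?_⟩
  rw [← L.apply_symm_apply y]
  exact (hL _ _).trans (hx _ (by
    rw [Submodule.mem_comap, LinearEquiv.coe_coe, L.apply_symm_apply]
    exact hy))

end Graph
end PfisterRam

namespace PfisterRam

/-! ### Residue forms and ramification. -/

section Residues

variable {F Γ : Type*} [Field F] [LinearOrderedCommGroupWithZero Γ] (v : Valuation F Γ)
variable {ι κ ι' κ' : Type*}

theorem toF_ne_zero (u : v.valuationSubringˣ) : toF v u ≠ 0 := by
  simp [toF]

theorem toF_mul (u u' : v.valuationSubringˣ) : toF v (u * u') = toF v u * toF v u' := rfl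

theorem toF_neg (u : v.valuationSubringˣ) : toF v (-u) = -toF v u := rfl

theorem res_ne_zero (u : v.valuationSubringˣ) : res v u ≠ 0 :=
  (IsLocalRing.residue_ne_zero_iff_isUnit _).2 u.isUnit

theorem res_mul (u u' : v.valuationSubringˣ) : res v (u * u') = res v u * res v u' := by
  simp [res]

theorem res_neg (u : v.valuationSubringˣ) : res v (-u) = -res v u := by
  simp [res]

theorem exists_toF_eq {x : F} (hx : v x = 1) : ∃ u, toF v u = x := by
  have hx0 : x ≠ 0 := by rintro rfl; simp at hx
  refine ⟨⟨⟨x, hx.le⟩, ⟨x⁻¹, ?_⟩, ?_, ?_⟩, rfl⟩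
  · rw [Valuation.mem_valuationSubring_iff, map_inv₀, hx, inv_one]
  · exact Subtype.ext (mul_inv_cancel₀ hx0)
  · exact Subtype.ext (inv_mul_cancel₀ hx0)

/-- The diagonal form `⟨u⟩ ⊥ π⟨w⟩`. -/
def graded (π : F) (u : ι → v.valuationSubringˣ) (w : κ → v.valuationSubringˣ) : ι ⊕ κ → F :=
  Sum.elim (fun i => toF v (u i)) fun j => π * toF v (w j)

theorem graded_ne_zero {π : F} (hπ : π ≠ 0) (u : ι → v.valuationSubringˣ)
    (w : κ → v.valuationSubringˣ) (i : ι ⊕ κ) : graded v π u w i ≠ 0 := by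
  rcases i with i | i <;> simp [graded, hπ, toF_ne_zero]

theorem diagIso_graded_swap [Fintype ι] [Fintype κ] {π : F} (hπ : π ≠ 0)
    (u : ι → v.valuationSubringˣ)
    (w : κ → v.valuationSubringˣ) : DiagIso (π • graded v π u w) (graded v π w u) :=
  diagIso_of_equiv_sq (Equiv.sumComm _ _) (Sum.elim (fun _ => 1) fun _ => π)
    (by rintro (i | i) <;> simp [hπ])
    (by rintro (i | i) <;> simp [graded]; ring)

/-- Scaling by `π` exchanges the residue forms, so results on second residue forms apply to first
ones. -/
theorem DiagIso.graded_swap [Fintype ι] [Fintype κ] [Fintype ι'] [Fintype κ'] {π : F}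
    (hπ : π ≠ 0) {u : ι → v.valuationSubringˣ}
    {w : κ → v.valuationSubringˣ} {u' : ι' → v.valuationSubringˣ} {w' : κ' → v.valuationSubringˣ}
    (h : DiagIso (graded v π u w) (graded v π u' w')) :
    DiagIso (graded v π w u) (graded v π w' u') :=
  (diagIso_graded_swap v hπ u w).symm.trans ((h.smul π).trans (diagIso_graded_swap v hπ u' w'))

/-- Vectors over the residue field lift, compatibly with the values of a unit diagonal form. -/
theorem exists_lift [Fintype ι] (c : ι → v.valuationSubringˣ) (x : ι → ResField v) :
    ∃ (y : ι → F) (r : v.valuationSubring), diagForm (fun i => toF v (c i)) y = r ∧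
      IsLocalRing.residue _ r = diagForm (fun i => res v (c i)) x := by
  choose y hy using fun i => IsLocalRing.residue_surjective (x i)
  refine ⟨fun i => y i, ∑ i, (c i : v.valuationSubring) * (y i * y i), ?_, ?_⟩
  · rw [diagForm_apply]
    push_cast
    rfl
  · rw [diagForm_apply, map_sum]
    simp [hy, res]

variable [v.IsRankOneDiscrete]

theorem exists_val_eq_zpow {π : F} (hπ : v.IsUniformizer π) {x : F} (hx : x ≠ 0) :
    ∃ n : ℤ, v x = v π ^ n := by
  have hx0 : v x ≠ 0 := (Valuation.ne_zero_iff v).2 hx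
  have h : Units.mk0 (v x) hx0 ∈ MonoidWithZeroHom.valueGroup (.ofClass v) :=
    MonoidWithZeroHom.mem_valueGroup _ ⟨x, rfl⟩
  rw [hπ.zpowers_eq_valueGroup, Subgroup.mem_zpowers_iff] at h
  obtain ⟨n, hn⟩ := h
  exact ⟨n, by simpa using (congrArg Units.val hn).symm⟩

/-- Up to squares, every nonzero element is a unit or a uniformizer times a unit. -/
theorem exists_sq_mul_unit {π : F} (hπ : v.IsUniformizer π) {x : F} (hx : x ≠ 0) :
    ∃ (t : F) (u : v.valuationSubringˣ), t ≠ 0 ∧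
      (x = t ^ 2 * toF v u ∨ x = t ^ 2 * (π * toF v u)) := by
  have hπ0 := hπ.ne_zero
  have hvπ := hπ.val_ne_zero
  obtain ⟨n, hn⟩ := exists_val_eq_zpow v hπ hx
  have h1 : v (x / π ^ n) = 1 := by
    rw [map_div₀, hn, map_zpow₀, div_self (zpow_ne_zero _ hvπ)]
  obtain ⟨u, hu⟩ := exists_toF_eq v h1
  have hxu : x = π ^ n * toF v u := by
    rw [hu, mul_div_cancel₀ _ (zpow_ne_zero _ hπ0)]
  rcases Int.even_or_odd' n with ⟨m, rfl | rfl⟩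
  · exact ⟨π ^ m, u, zpow_ne_zero _ hπ0, Or.inl (by
      rw [hxu, mul_comm, zpow_mul, mul_comm, zpow_ofNat, ← zpow_natCast (π ^ m), ← zpow_mul,
        ← zpow_natCast π, ← zpow_mul, mul_comm m])⟩
  · exact ⟨π ^ m, u, zpow_ne_zero _ hπ0, Or.inr (by
      rw [hxu, zpow_add₀ hπ0, zpow_one, mul_assoc, ← zpow_natCast (π ^ m), ← zpow_mul,
        mul_comm m]; rfl)⟩

theorem exists_graded {ι : Type*} {π : F} (hπ : v.IsUniformizer π) [Fintype ι] {c : ι → F}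
    (hc : ∀ i, c i ≠ 0) :
    ∃ (p : ι → Prop) (e : ι ≃ {i // p i} ⊕ {i // ¬ p i}) (u : {i // p i} → v.valuationSubringˣ)
      (w : {i // ¬ p i} → v.valuationSubringˣ) (t : ι → F), (∀ i, t i ≠ 0) ∧
      ∀ i, c i = t i ^ 2 * graded v π u w (e i) := by
  classical
  choose t u ht h using fun i => exists_sq_mul_unit v hπ (hc i)
  refine ⟨fun i => c i = t i ^ 2 * toF v (u i), (Equiv.sumCompl _).symm, fun i => u i,
    fun i => u i, t, ht, fun i => ?_⟩
  by_cases hi : c i = t i ^ 2 * toF v (u i)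
  · rw [Equiv.sumCompl_symm_apply_of_pos (p := fun i => c i = t i ^ 2 * toF v (u i)) hi]
    exact hi
  · rw [Equiv.sumCompl_symm_apply_of_neg (p := fun i => c i = t i ^ 2 * toF v (u i)) hi]
    exact (h i).resolve_left hi

variable [Fintype ι] [Fintype κ] [Fintype ι'] [Fintype κ']

/-- Two decompositions of a form have Witt equivalent second residue forms. -/
theorem exists_isLagrangian_secondResidue (h2 : (2 : F) ≠ 0) {π : F} (hπ : v.IsUniformizer π)
    {u : ι → v.valuationSubringˣ} {w : κ → v.valuationSubringˣ} {u' : ι' → v.valuationSubringˣ}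
    {w' : κ' → v.valuationSubringˣ} (h : DiagIso (graded v π u w) (graded v π u' w')) :
    ∃ M, IsLagrangian (Sum.elim (fun j => res v (w j)) (-fun j => res v (w' j))) M := by
  obtain ⟨U, hU⟩ := h.exists_isLagrangian h2 (graded_ne_zero v hπ.ne_zero u w)
  let ϖ : v.valuationSubring := ⟨π, hπ.val_lt_one.le⟩
  -- Regroup the difference as `⟨u, -u'⟩ ⊥ π⟨w, -w'⟩`.
  obtain ⟨U', hU'⟩ := hU.reindex (Equiv.sumSumSumComm ι κ ι' κ')
    (c' := Sum.elim (fun i => algebraMap v.valuationSubring F ((Sum.elim u (-u') i :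
      v.valuationSubringˣ) : v.valuationSubring))
      fun j => algebraMap v.valuationSubring F ϖ *
        algebraMap v.valuationSubring F ((Sum.elim w (-w') j :
      v.valuationSubringˣ) : v.valuationSubring)) (by
        rintro ((i | i) | (i | i)) <;> simp [graded, toF, ϖ])
  obtain ⟨M, hM⟩ := hU'.exists_residue (ϖ := ϖ) (fun h => hπ.ne_zero (congrArg Subtype.val h))
    (Valuation.IsUniformizer.is_generator hπ) _ _
  refine ⟨M, ?_⟩
  convert hM using 1
  ext (j | j) <;> simp [res]

theorem card_le_of_isAniso (h2 : (2 : F) ≠ 0) {π : F} (hπ : v.IsUniformizer π)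
    {u : ι → v.valuationSubringˣ} {w : κ → v.valuationSubringˣ} {u' : ι' → v.valuationSubringˣ}
    {w' : κ' → v.valuationSubringˣ} (h : DiagIso (graded v π u w) (graded v π u' w'))
    (ha : IsAniso fun j => res v (w' j)) : Fintype.card κ' ≤ Fintype.card κ := by
  obtain ⟨M, hM⟩ := exists_isLagrangian_secondResidue v h2 hπ h
  exact hM.card_le (fun _ => res_ne_zero v _) (fun _ => res_ne_zero v _) ha

theorem diagIso_res_of_isAniso (h2 : (2 : F) ≠ 0) {π : F} (hπ : v.IsUniformizer π)
    {u : ι → v.valuationSubringˣ} {w : κ → v.valuationSubringˣ} {u' : ι' → v.valuationSubringˣ}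
    {w' : κ' → v.valuationSubringˣ} (h : DiagIso (graded v π u w) (graded v π u' w'))
    (ha : IsAniso fun j => res v (w' j)) (hcard : Fintype.card κ' = Fintype.card κ) :
    DiagIso (fun j => res v (w j)) fun j => res v (w' j) := by
  obtain ⟨M, hM⟩ := exists_isLagrangian_secondResidue v h2 hπ h
  exact hM.diagIso (fun _ => res_ne_zero v _) (fun _ => res_ne_zero v _) ha hcard

variable {V : Type*} [AddCommGroup V] [Module F V] {φ : QuadraticForm F V}

/-- A form with a metabolic second residue form has only hyperbolic second residue forms. -/
theorem isHyperbolic_of_isLagrangian (h2 : (2 : F) ≠ 0) (hv : (2 : ResField v) ≠ 0) {π : F}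
    (hπ : v.IsUniformizer π) {n : ℕ} {ρ : QuadraticForm (ResField v) (Fin n → ResField v)}
    (hρ : IsSecondResidueForm v π φ ρ) {u' : ι' → v.valuationSubringˣ}
    {w' : κ' → v.valuationSubringˣ} (h : φ.Equivalent (diagForm (graded v π u' w')))
    {M' : Submodule (ResField v) (κ' → ResField v)}
    (hM' : IsLagrangian (fun j => res v (w' j)) M') : IsHyperbolic ρ := by
  obtain ⟨m, u, w, h1, rfl⟩ := hρ
  obtain ⟨M, hM⟩ := exists_isLagrangian_secondResidue v h2 hπ (w := w) (w' := w')
    (QuadraticMap.Equivalent.trans (QuadraticMap.Equivalent.symm h1) h)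
  obtain ⟨N, hN⟩ := hM.reduction (fun _ => res_ne_zero v _) (fun _ => res_ne_zero v _) hM'
  exact hN.isHyperbolic hv fun _ => res_ne_zero v _

/-- Forms with an orthogonal basis of vectors of unit value are unramified. -/
theorem not_isRamified_of_units (h2 : (2 : F) ≠ 0) (hv : (2 : ResField v) ≠ 0)
    {u : ι → v.valuationSubringˣ} (h : φ.Equivalent (diagForm fun i => toF v (u i))) :
    ¬ IsRamified v φ := by
  rintro ⟨π, hπ, n, ρ, hρ, hnh⟩
  refine hnh (isHyperbolic_of_isLagrangian v h2 hv hπ hρ (κ' := Empty) (u' := u)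
    (w' := Empty.elim) (h.trans ?_) (M' := ⊤) fun x => ?_)
  · exact diagIso_of_equiv (Equiv.sumEmpty _ _).symm fun _ => rfl
  · exact ⟨fun _ y _ => by simp [diagBilin_apply], fun _ => trivial⟩

/-- If `c` has second residue form `w`, then `⟨1, -f⟩ ⊗ c` has second residue form `w ⊥ -w`, for
which the diagonal is a Lagrangian. -/
theorem not_isRamified_of_dbl (h2 : (2 : F) ≠ 0) (hv : (2 : ResField v) ≠ 0)
    {c : ι → F} (hc : ∀ i, c i ≠ 0) {f : v.valuationSubringˣ} (hf : res v f = 1)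
    (h : φ.Equivalent (diagForm (dbl (-toF v f) c))) : ¬ IsRamified v φ := by
  classical
  rintro ⟨π, hπ, n, ρ, hρ, hnh⟩
  obtain ⟨p, e, u, w, t, ht, htc⟩ := exists_graded v hπ hc
  obtain ⟨M, hM⟩ := isLagrangian_diagonal (c := fun j => res v (w j)) fun _ => res_ne_zero v _
  refine hnh (isHyperbolic_of_isLagrangian v h2 hv hπ hρ (u' := Sum.elim u fun i => -f * u i)
    (w' := Sum.elim w fun i => -f * w i) (h.trans ?_) (M' := M) ?_)
  · refine ((diagIso_of_equiv_sq e t ht htc).dbl _).trans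
      (diagIso_of_equiv (Equiv.sumSumSumComm _ _ _ _) ?_)
    rintro ((i | i) | (i | i)) <;> simp [graded, dbl, toF_mul, toF_neg]
    ring
  · convert hM using 1
    ext (j | j) <;> simp [res_mul, res_neg, hf]

theorem isHyperbolic_of_not_isRamified {π : F} (hπ : v.IsUniformizer π)
    {u : ι → v.valuationSubringˣ} {w : κ → v.valuationSubringˣ}
    (h : φ.Equivalent (diagForm (graded v π u w))) (hφ : ¬ IsRamified v φ) :
    IsHyperbolic (diagForm fun j => res v (w j)) := by
  by_contra hnh
  let e := Fintype.equivFin ι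
  let e' := Fintype.equivFin κ
  refine hφ ⟨π, hπ, _, diagForm fun j => res v (w (e'.symm j)), ⟨_, fun i => u (e.symm i),
    fun i => w (e'.symm i), h.trans (diagIso_of_equiv (e.sumCongr e') ?_), rfl⟩, ?_⟩
  · rintro (i | i) <;> simp [graded]
  · rintro ⟨n, hn⟩
    refine hnh ⟨n, QuadraticMap.Equivalent.trans (diagIso_of_equiv e' fun i => ?_) hn⟩
    simp

end Residues
end PfisterRam

namespace PfisterRam

/-! ### Pfister forms and their roundness. -/

section Pfister

variable {K : Type*} [Field K]

/-- The diagonal entries of a Pfister form. -/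
def pfisterCoeff {R : Type*} [CommMonoid R] [HasDistribNeg R] {d : ℕ} (a : Fin d → R)
    (S : Finset (Fin d)) : R :=
  ∏ i ∈ S, -a i

theorem pfisterCoeff_ne_zero {d : ℕ} {a : Fin d → K} (ha : ∀ i, a i ≠ 0) (S : Finset (Fin d)) :
    pfisterCoeff a S ≠ 0 :=
  Finset.prod_ne_zero_iff.2 fun i _ => neg_ne_zero.2 (ha i)

theorem pfisterCoeff_comp {d : ℕ} (a : Fin d → K) (σ : Equiv.Perm (Fin d)) :
    DiagIso (pfisterCoeff fun i => a (σ i)) (pfisterCoeff a) :=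
  diagIso_of_equiv σ.finsetCongr fun S => by simp [pfisterCoeff]

/-- Subsets of the slots are split by whether they contain the new slot. -/
theorem pfisterCoeff_cons {d : ℕ} (b : K) (a : Fin d → K) :
    DiagIso (pfisterCoeff (Fin.cons b a : Fin (d + 1) → K)) (dbl (-b) (pfisterCoeff a)) := by
  classical
  let g : Finset (Fin d) ⊕ Finset (Fin d) → Finset (Fin (d + 1)) :=
    Sum.elim (fun S => S.map (Fin.succEmb d)) fun S => insert 0 (S.map (Fin.succEmb d))
  have h0 : ∀ S : Finset (Fin d), (0 : Fin (d + 1)) ∉ S.map (Fin.succEmb d) := by simp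
  have hg : Function.Bijective g := by
    refine (Fintype.bijective_iff_injective_and_card g).2 ⟨?_, ?_⟩
    · rintro (S | S) (T | T) h
      · exact congrArg _ (Finset.map_injective _ h)
      · have h' : S.map (Fin.succEmb d) = insert 0 (T.map (Fin.succEmb d)) := h
        exact absurd (h' ▸ Finset.mem_insert_self _ _) (h0 S)
      · have h' : insert 0 (S.map (Fin.succEmb d)) = T.map (Fin.succEmb d) := h
        exact absurd (h' ▸ Finset.mem_insert_self _ _) (h0 T)
      · have h1 := congrArg (Finset.erase · 0) h
        simp only [g, Sum.elim_inr, Finset.erase_insert (h0 _)] at h1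
        exact congrArg _ (Finset.map_injective _ h1)
    · simp [pow_succ, mul_two]
  refine (diagIso_of_equiv (Equiv.ofBijective g hg) ?_).symm
  rintro (S | S)
  · simp [g, dbl, pfisterCoeff]
  · simp [g, dbl, pfisterCoeff, Finset.prod_insert (h0 S)]

theorem pfisterCoeff_snoc {d : ℕ} (b : K) (a : Fin d → K) :
    DiagIso (pfisterCoeff (Fin.snoc a b : Fin (d + 1) → K)) (dbl (-b) (pfisterCoeff a)) := by
  refine DiagIso.trans ?_ (pfisterCoeff_cons b a)
  rw [Fin.snoc_eq_cons_rotate]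
  exact pfisterCoeff_comp _ _

variable {ι κ : Type*} [Fintype ι] [Fintype κ]

theorem IsRound.of_diagIso {c : ι → K} {c' : κ → K} (hc : IsRound c') (h : DiagIso c c') :
    IsRound c := by
  intro x hx
  obtain ⟨f⟩ := id h
  have hf : diagForm c' (f x) = diagForm c x := f.map_app x
  rw [← hf] at hx ⊢
  exact (h.smul _).trans ((hc _ hx).trans h.symm)

theorem IsAniso.of_diagIso {c : ι → K} {c' : κ → K} (hc : IsAniso c') (h : DiagIso c c') :
    IsAniso c := by
  intro x hx
  obtain ⟨f⟩ := id h
  have h1 : f x = 0 := hc _ (by rw [f.map_app, hx])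
  rw [← f.symm_apply_apply x, h1, map_zero]

theorem isRound_pfisterCoeff {d : ℕ} (a : Fin d → K) : IsRound (pfisterCoeff a) := by
  induction d with
  | zero =>
    intro x hx
    have h1 : ∀ S, pfisterCoeff a S = 1 := fun S => by
      rw [Subsingleton.elim S ∅, pfisterCoeff, Finset.prod_empty]
    have h2 : diagForm (pfisterCoeff a) x = x ∅ ^ 2 := by
      rw [diagForm_apply, Fintype.sum_unique, h1, Subsingleton.elim default ∅]
      ring
    rw [h2] at hx ⊢
    exact diagIso_of_sq (fun _ => x ∅) (fun _ => pow_ne_zero_iff two_ne_zero |>.1 hx) fun _ => rfl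
  | succ d ih =>
    rw [← Fin.cons_self_tail a]
    exact ((ih _).dbl _).of_diagIso (pfisterCoeff_cons _ _)

end Pfister

/-! ### Normalizing the slots of a Pfister form. -/

section Valued

variable {F Γ : Type*} [Field F] [LinearOrderedCommGroupWithZero Γ] (v : Valuation F Γ)

theorem toF_pfisterCoeff {d : ℕ} (a : Fin d → v.valuationSubringˣ) :
    pfisterCoeff (fun i => toF v (a i)) = fun S => toF v (pfisterCoeff a S) := by
  ext S
  let g : v.valuationSubringˣ →* F :=
    (v.valuationSubring.subtype : v.valuationSubring →* F).comp (Units.coeHom _)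
  have hg : ∀ u, toF v u = g u := fun _ => rfl
  simp only [pfisterCoeff, hg, map_prod]
  rfl

theorem res_pfisterCoeff {d : ℕ} (a : Fin d → v.valuationSubringˣ) :
    pfisterCoeff (fun i => res v (a i)) = fun S => res v (pfisterCoeff a S) := by
  ext S
  let g : v.valuationSubringˣ →* ResField v :=
    (IsLocalRing.residue v.valuationSubring : v.valuationSubring →* _).comp (Units.coeHom _)
  have hg : ∀ u, res v u = g u := fun _ => rfl
  simp only [pfisterCoeff, ← res_neg]
  simp only [hg, map_prod]

theorem comp_cons {α β : Type*} (f : α → β) {d : ℕ} (b : α) (a : Fin d → α) :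
    (fun i => f ((Fin.cons b a : Fin (d + 1) → α) i)) = Fin.cons (f b) fun i => f (a i) := by
  ext i
  refine Fin.cases rfl (fun i => rfl) i

/-- A Pfister form with unit slots and isotropic residue form has a slot of residue one. -/
theorem exists_slot_res_eq_one {d : ℕ} (a : Fin d → v.valuationSubringˣ)
    (ha : ¬ IsAniso (pfisterCoeff fun i => res v (a i))) :
    ∃ (n : ℕ) (_ : d = n + 1) (f : v.valuationSubringˣ) (a' : Fin n → v.valuationSubringˣ),
      res v f = 1 ∧ DiagIso (pfisterCoeff fun i => toF v (a i))
        (dbl (-toF v f) (pfisterCoeff fun i => toF v (a' i))) := by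
  induction d with
  | zero =>
    refine absurd (fun x hx => ?_) ha
    ext S
    rw [diagForm_apply, Fintype.sum_unique, Subsingleton.elim default S, pfisterCoeff,
      Subsingleton.elim S ∅, Finset.prod_empty, one_mul] at hx
    rw [Subsingleton.elim S ∅]
    exact mul_self_eq_zero.1 hx
  | succ d ih =>
    obtain ⟨b, a, rfl⟩ : ∃ b a', a = Fin.cons b a' := ⟨_, _, (Fin.cons_self_tail a).symm⟩
    rw [comp_cons (res v)] at ha
    rw [comp_cons (toF v)]
    refine ⟨d, rfl, ?_⟩
    -- If the tail is anisotropic over the residue field, an isotropic vector gives `s̄ = b̄ t̄` for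
    -- values `s̄`, `t̄` of the tail, both nonzero. They lift to unit values `s`, `t` of the tail
    -- over `F`. If the tail is isotropic, recurse and bring its slot to the front.
    by_cases ha' : IsAniso (pfisterCoeff fun i => res v (a i))
    · have h1 : ¬ IsAniso (dbl (-res v b) (pfisterCoeff fun i => res v (a i))) :=
        fun h => ha (h.of_diagIso (pfisterCoeff_cons _ _))
      simp only [IsAniso, not_forall] at h1
      obtain ⟨z, hz, hz0⟩ := h1
      rw [dbl, diagForm_sumElim, diagForm_smul] at hz
      set x := fun i => z (Sum.inl i) with hx
      set y := fun i => z (Sum.inr i) with hy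
      have hy0 : diagForm (pfisterCoeff fun i => res v (a i)) y ≠ 0 := by
        intro h0
        rw [h0, mul_zero, add_zero] at hz
        refine hz0 (funext ?_)
        rintro (i | i)
        · exact congrFun (ha' _ hz) i
        · exact congrFun (ha' _ h0) i
      have hround := isRound_pfisterCoeff fun i => toF v (a i)
      rw [res_pfisterCoeff] at hz hy0
      obtain ⟨x', s, hs, hrs⟩ := exists_lift v (pfisterCoeff a) x
      obtain ⟨y', t, ht, hrt⟩ := exists_lift v (pfisterCoeff a) y
      rw [← hrt] at hy0 hz
      rw [← hrs] at hz
      have hs0 : IsLocalRing.residue _ s ≠ 0 := by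
        intro h0
        rw [h0, zero_add] at hz
        exact mul_ne_zero (neg_ne_zero.2 (res_ne_zero v b)) hy0 hz
      obtain ⟨s, rfl⟩ := (IsLocalRing.residue_ne_zero_iff_isUnit s).1 hs0
      obtain ⟨t, rfl⟩ := (IsLocalRing.residue_ne_zero_iff_isUnit t).1 hy0
      rw [toF_pfisterCoeff] at hround
      have hsr := hround x' (by rw [hs]; exact toF_ne_zero v s)
      have htr := hround y' (by rw [ht]; exact toF_ne_zero v t)
      rw [hs] at hsr
      rw [ht] at htr
      have hsr' : DiagIso (toF v s⁻¹ • fun S => toF v (pfisterCoeff a S))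
          fun S => toF v (pfisterCoeff a S) := by
        refine (hsr.symm.smul _).trans ?_
        rw [smul_smul]
        have : toF v s⁻¹ * ((s : v.valuationSubring) : F) = 1 :=
          congrArg Subtype.val s.inv_mul
        rw [this, one_smul]
      -- Roundness of the tail allows the slot `b` to be multiplied by `s⁻¹t`, and `s̄ = b̄ t̄`
      -- makes the residue 1.
      refine ⟨b * (s⁻¹ * t), a, ?_, (pfisterCoeff_cons _ _).trans ?_⟩
      · have hrs' : res v s⁻¹ * res v s = 1 := by
          rw [← res_mul, inv_mul_cancel]
          simp [res]
        have hz' : res v s - res v b * res v t = 0 := by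
          rw [← hz]
          simp only [res]
          ring
        rw [res_mul, res_mul]
        linear_combination hrs' - res v s⁻¹ * hz'
      · rw [toF_pfisterCoeff]
        refine (DiagIso.refl _).sumElim ?_
        rw [toF_mul, toF_mul, neg_mul_eq_neg_mul, mul_smul]
        exact ((hsr'.smul_mul htr).smul _).symm
    · obtain ⟨n, rfl, f, a', hf, h⟩ := ih a ha'
      refine ⟨f, Fin.cons b a', hf, (pfisterCoeff_cons _ _).trans ((h.dbl _).trans
        ((dbl_comm _ _ _).trans (DiagIso.dbl _ ?_)))⟩
      rw [comp_cons (toF v)]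
      exact (pfisterCoeff_cons _ _).symm

variable [v.IsRankOneDiscrete]

/-- All slots but one of a Pfister form can be chosen to be units. -/
theorem exists_unit_slots {π : F} (hπ : v.IsUniformizer π) {e : ℕ} (a : Fin (e + 1) → F)
    (ha : ∀ i, a i ≠ 0) :
    ∃ (u : v.valuationSubringˣ) (b : F) (a' : Fin e → v.valuationSubringˣ),
      (b = toF v u ∨ b = π * toF v u) ∧
      DiagIso (pfisterCoeff a) (dbl (-b) (pfisterCoeff fun i => toF v (a' i))) := by
  induction e with
  | zero =>
    rw [← Fin.cons_self_tail a]
    obtain ⟨t, u, ht, h⟩ := exists_sq_mul_unit v hπ (ha 0)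
    have key : ∀ b, a 0 = t ^ 2 * b →
        DiagIso (pfisterCoeff (Fin.cons (a 0) (Fin.tail a) : Fin 1 → F))
          (dbl (-b) (pfisterCoeff fun i => toF v (Fin.elim0 i))) := by
      intro b hb
      rw [hb]
      refine (pfisterCoeff_cons _ _).trans ?_
      rw [neg_mul_eq_mul_neg, Subsingleton.elim (Fin.tail a) fun i => toF v (Fin.elim0 i)]
      exact dbl_sq_mul ht _ _
    rcases h with h | h
    · exact ⟨u, _, fun i => Fin.elim0 i, Or.inl rfl, key _ h⟩
    · exact ⟨u, _, fun i => Fin.elim0 i, Or.inr rfl, key _ h⟩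
  | succ e ih =>
    obtain ⟨u, b, a', hb, h⟩ := ih (Fin.tail a) fun i => ha _
    obtain ⟨t, u', ht, h'⟩ := exists_sq_mul_unit v hπ (ha 0)
    have key : ∀ x, a 0 = t ^ 2 * x → DiagIso (pfisterCoeff a)
        (dbl (-x) (dbl (-b) (pfisterCoeff fun i => toF v (a' i)))) := by
      intro x hx
      rw [← Fin.cons_self_tail a, hx]
      refine (pfisterCoeff_cons _ _).trans ((h.dbl _).trans ?_)
      rw [neg_mul_eq_mul_neg]
      exact dbl_sq_mul ht _ _
    have key' : ∀ x : v.valuationSubringˣ, DiagIso (pfisterCoeff a)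
          (dbl (-toF v x) (dbl (-b) (pfisterCoeff fun i => toF v (a' i)))) →
        DiagIso (pfisterCoeff a) (dbl (-b) (pfisterCoeff fun i =>
          toF v ((Fin.cons x a' : Fin (e + 1) → v.valuationSubringˣ) i))) := by
      intro x hx
      refine hx.trans ((dbl_comm _ _ _).trans (DiagIso.dbl _ ?_))
      rw [comp_cons (toF v)]
      exact (pfisterCoeff_cons _ _).symm
    rcases h' with h' | h'
    · exact ⟨u, b, _, hb, key' u' (key _ h')⟩
    · rcases hb with rfl | rfl
      · refine ⟨u', _, Fin.cons u a', Or.inr rfl, (key _ h').trans (DiagIso.dbl _ ?_)⟩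
        rw [comp_cons (toF v)]
        exact (pfisterCoeff_cons _ _).symm
      -- Two uniformizer slots merge: `⟪πu', πu⟫ ≅ ⟪-u'u, πu⟫`, after discarding the square `π²`.
      · refine ⟨u, _, _, Or.inr rfl, key' (-(u' * u)) ((key _ h').trans ?_)⟩
        have hb0 : -(π * toF v u) ≠ 0 := by simp [hπ.ne_zero, toF_ne_zero]
        refine (dbl_mul_dbl hb0 _ _).symm.trans ?_
        have : -(π * toF v u') * -(π * toF v u) = π ^ 2 * -toF v (-(u' * u)) := by
          rw [toF_neg, toF_mul]
          ring
        rw [this]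
        exact dbl_sq_mul hπ.ne_zero _ _

end Valued
end PfisterRam

namespace PfisterRam

/-! ### Similar Pfister forms, and doubles by a uniformizer slot. -/

section Slots

theorem smul_isAniso {K ι : Type*} [Field K] [Fintype ι] {c : ι → K} {e : K} (he : e ≠ 0)
    (hc : IsAniso c) : IsAniso (e • c) := fun x hx => by
  rw [diagForm_smul, mul_eq_zero] at hx
  exact hc x (hx.resolve_left he)

/-- If multiples of two Pfister forms by a scalar are isometric, so are the Pfister forms. -/
theorem diagIso_of_smul_diagIso {K : Type*} [Field K] {n m : ℕ} {a : Fin n → K} {a' : Fin m → K}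
    {g : K} (hg : g ≠ 0) (h : DiagIso (g • pfisterCoeff a) (pfisterCoeff a')) :
    DiagIso (pfisterCoeff a) (pfisterCoeff a') := by
  classical
  obtain ⟨f⟩ := id h
  -- The entry of `pfisterCoeff a` at `∅` is 1, so the second Pfister form represents `g` and, being
  -- round, absorbs it.
  have h1 : diagForm (pfisterCoeff a') (f (Pi.single ∅ 1)) = g := by
    rw [f.map_app, ← diagBilin_self, diagBilin_single]
    simp [pfisterCoeff]
  have h2 := isRound_pfisterCoeff a' _ (by rw [h1]; exact hg)
  rw [h1] at h2
  refine DiagIso.trans (diagIso_of_sq (fun _ => g⁻¹) (fun _ => inv_ne_zero hg)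
    (c' := g • g • pfisterCoeff a)
    fun i => ?_) ((h.smul g).trans h2)
  simp only [Pi.smul_apply, smul_eq_mul]
  field_simp

variable {F Γ : Type*} [Field F] [LinearOrderedCommGroupWithZero Γ] (v : Valuation F Γ)

theorem dbl_units_eq_graded {n : ℕ} (π : F) (u : v.valuationSubringˣ)
    (a : Fin n → v.valuationSubringˣ) :
    dbl (-(π * toF v u)) (pfisterCoeff fun i => toF v (a i)) =
      graded v π (pfisterCoeff a) fun S => -u * pfisterCoeff a S := by
  rw [toF_pfisterCoeff]
  ext (i | i) <;> simp [dbl, graded, toF_mul, toF_neg, mul_assoc]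

theorem diagIso_pfisterCoeff_cons_units {n : ℕ} (u : v.valuationSubringˣ)
    (a : Fin n → v.valuationSubringˣ) :
    DiagIso (dbl (-toF v u) (pfisterCoeff fun i => toF v (a i)))
      (pfisterCoeff fun i => toF v ((Fin.cons u a : Fin (n + 1) → v.valuationSubringˣ) i)) := by
  rw [comp_cons (toF v)]
  exact (pfisterCoeff_cons _ _).symm

theorem isPfister_pfister {n : ℕ} {a : Fin n → F} (ha : ∀ i, a i ≠ 0) : IsPfister n (pfister a) :=
  ⟨a, ha, QuadraticMap.Equivalent.refl _⟩

theorem cons_ne_zero {n : ℕ} {b : F} (hb : b ≠ 0) (a : Fin n → v.valuationSubringˣ)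
    (i : Fin (n + 1)) : (Fin.cons b fun i => toF v (a i) : Fin (n + 1) → F) i ≠ 0 :=
  Fin.cases hb (fun i => toF_ne_zero v (a i)) i

/-- A double of `⟨1, -b⟩` with `b` a uniformizer has residue forms of equal dimension. -/
theorem exists_graded_of_dbl [v.IsRankOneDiscrete] {π : F} (hπ : v.IsUniformizer π)
    (u : v.valuationSubringˣ) {ι : Type*} [Fintype ι] {c : ι → F} (hc : ∀ i, c i ≠ 0) :
    ∃ (p : ι → Prop) (u₁ : {i // p i} ⊕ {i // ¬ p i} → v.valuationSubringˣ)
      (w₁ : {i // ¬ p i} ⊕ {i // p i} → v.valuationSubringˣ), ∀ [Fintype {i // p i}]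
      [Fintype {i // ¬ p i}], DiagIso (dbl (-(π * toF v u)) c) (graded v π u₁ w₁) := by
  obtain ⟨p, e, u', w', t, ht, h⟩ := exists_graded v hπ hc
  refine ⟨p, Sum.elim u' fun i => -u * w' i, Sum.elim w' fun i => -u * u' i, ?_⟩
  intro _ _
  refine ((diagIso_of_equiv_sq e t ht h).dbl _).trans (diagIso_of_equiv_sq
    (((Equiv.refl _).sumCongr (Equiv.sumComm _ _)).trans (Equiv.sumSumSumComm _ _ _ _))
    (Sum.elim (fun _ => 1) (Sum.elim (fun _ => 1) fun _ => π)) ?_ ?_)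
  · rintro (i | (i | i)) <;> simp [hπ.ne_zero]
  · rintro ((i | i) | (i | i)) <;> simp [graded, dbl, toF_mul, toF_neg] <;> ring

end Slots

/-! ### The separating divisor in the two cases. -/

section Divisors

variable {F Γ V V₁ V₂ : Type*} [Field F] [Invertible (2 : F)] [LinearOrderedCommGroupWithZero Γ]
  (v : Valuation F Γ) [v.IsRankOneDiscrete] [AddCommGroup V] [Module F V] [AddCommGroup V₁]
  [Module F V₁] [AddCommGroup V₂] [Module F V₂] {φ : QuadraticForm F V} {φ₁ : QuadraticForm F V₁}
  {φ₂ : QuadraticForm F V₂}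

/-- A Pfister form divisible by `⟪b, a_1, …⟫` is a multiple of `⟨1, -b⟩`. -/
theorem Divides.exists_dbl {n m : ℕ} {φ : QuadraticForm F V} (hφ : IsPfister m φ) {b : F}
    {a : Fin n → F} (h : Divides (pfister (Fin.cons b a : Fin (n + 1) → F)) φ) :
    ∃ (r : ℕ) (c : Finset (Fin n) × Fin r → F), (∀ i, c i ≠ 0) ∧
      φ.Equivalent (diagForm (dbl (-b) c)) := by
  have h2 : (2 : F) ≠ 0 := Invertible.ne_zero 2
  obtain ⟨a', ha', h'⟩ := hφ
  obtain ⟨r, δ, hδ⟩ := Divides.exists_diagForm h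
  have h3 : φ.Equivalent (diagForm (dbl (-b) fun p : Finset (Fin n) × Fin r =>
      pfisterCoeff a p.1 * δ p.2)) := by
    refine hδ.trans ((DiagIso.mul_prod (pfisterCoeff_cons b a) δ).trans
      (diagIso_of_equiv (Equiv.sumProdDistrib _ _ _) ?_))
    rintro ⟨i | i, j⟩ <;> simp [dbl, mul_assoc]
  have h4 : DiagIso (pfisterCoeff a') _ := QuadraticMap.Equivalent.trans h'.symm h3
  exact ⟨r, _, fun i => h4.ne_zero h2 (pfisterCoeff_ne_zero ha') (Sum.inl i), h3⟩

theorem divides_pfister_cons {n : ℕ} {b x : F} {a : Fin n → F}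
    (h : φ.Equivalent (diagForm (dbl x (dbl (-b) (pfisterCoeff a))))) :
    Divides (pfister (Fin.cons b a : Fin (n + 1) → F)) φ :=
  divides_of_equivalent_dbl (QuadraticMap.Equivalent.trans h
    (DiagIso.dbl x (pfisterCoeff_cons b a).symm))

theorem not_divides_of_isRamified (hv : (2 : ResField v) ≠ 0) {n m : ℕ}
    (hφ : IsPfister m φ) (hr : IsRamified v φ) {f : v.valuationSubringˣ} (hf : res v f = 1)
    (a : Fin n → v.valuationSubringˣ) :
    ¬ Divides (pfister (Fin.cons (toF v f) fun i => toF v (a i) : Fin (n + 1) → F)) φ := by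
  intro h
  obtain ⟨r, c, hc, h⟩ := h.exists_dbl hφ
  exact not_isRamified_of_dbl v (Invertible.ne_zero 2) hv hc hf h hr

theorem exists_divisor_of_not_isRamified (hv : (2 : ResField v) ≠ 0) {n : ℕ}
    (h₁ : IsPfister (n + 2) φ₁) (h₂ : IsPfister (n + 2) φ₂) (hr₁ : IsRamified v φ₁)
    (hr₂ : ¬ IsRamified v φ₂) :
    ∃ γ : QuadraticForm F (Finset (Fin (n + 1)) → F), IsPfister (n + 1) γ ∧
      ((Divides γ φ₁ ∧ ¬ Divides γ φ₂) ∨ (Divides γ φ₂ ∧ ¬ Divides γ φ₁)) := by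
  classical
  have h2 : (2 : F) ≠ 0 := Invertible.ne_zero 2
  -- Once `φ₂` has a slot `f` of residue 1, deleting a different slot gives the required divisor.
  have key : ∀ (x : F) (f : v.valuationSubringˣ) (a : Fin n → v.valuationSubringˣ), res v f = 1 →
      φ₂.Equivalent (diagForm (dbl x (dbl (-toF v f) (pfisterCoeff fun i => toF v (a i))))) →
      ∃ γ : QuadraticForm F (Finset (Fin (n + 1)) → F), IsPfister (n + 1) γ ∧
        ((Divides γ φ₁ ∧ ¬ Divides γ φ₂) ∨ (Divides γ φ₂ ∧ ¬ Divides γ φ₁)) :=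
    fun x f a hf h => ⟨_, isPfister_pfister (cons_ne_zero v (toF_ne_zero v f) a),
      Or.inr ⟨divides_pfister_cons h, not_divides_of_isRamified v hv h₁ hr₁ hf a⟩⟩
  obtain ⟨π, hπ, -⟩ := id hr₁
  obtain ⟨a₂, ha₂, hφ₂⟩ := id h₂
  obtain ⟨u₂, b₂, a₂', hb₂, h⟩ := exists_unit_slots v hπ a₂ ha₂
  replace hφ₂ := QuadraticMap.Equivalent.trans hφ₂ h
  rcases hb₂ with rfl | rfl
  · have hφ₂' := QuadraticMap.Equivalent.trans hφ₂ (diagIso_pfisterCoeff_cons_units v u₂ a₂')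
    by_cases ha : IsAniso (pfisterCoeff fun i => res v
      ((Fin.cons u₂ a₂' : Fin (n + 2) → v.valuationSubringˣ) i))
    · obtain ⟨a₁, ha₁, hφ₁⟩ := id h₁
      obtain ⟨u₁, b₁, a₁', hb₁, h⟩ := exists_unit_slots v hπ a₁ ha₁
      replace hφ₁ := QuadraticMap.Equivalent.trans hφ₁ h
      rcases hb₁ with rfl | rfl
      · have hφ₁' := QuadraticMap.Equivalent.trans hφ₁ (diagIso_pfisterCoeff_cons_units v u₁ a₁')
        rw [toF_pfisterCoeff] at hφ₁'
        exact absurd hr₁ (not_isRamified_of_units v h2 hv hφ₁')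
      obtain ⟨x, a₁, rfl⟩ : ∃ x a, a₁' = Fin.cons x a := ⟨_, _, (Fin.cons_self_tail a₁').symm⟩
      refine ⟨_, isPfister_pfister (cons_ne_zero v
        (mul_ne_zero hπ.ne_zero (toF_ne_zero v u₁)) a₁), Or.inl ⟨divides_pfister_cons
        (hφ₁.trans (((diagIso_pfisterCoeff_cons_units v x a₁).symm.dbl _).trans
          (dbl_comm _ _ _))), fun hdiv => ?_⟩⟩
      obtain ⟨r, c, hc, hφc⟩ := hdiv.exists_dbl h₂
      obtain ⟨p, u, w, hg⟩ := exists_graded_of_dbl v hπ u₁ hc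
      rw [toF_pfisterCoeff] at hφ₂'
      have h3 : DiagIso (graded v π u w) (graded v π
          (pfisterCoeff (Fin.cons u₂ a₂' : Fin (n + 2) → v.valuationSubringˣ)) Empty.elim) :=
        hg.symm.trans ((hφc.symm.trans hφ₂').trans
          (diagIso_of_equiv (Equiv.sumEmpty _ _).symm fun _ => rfl))
      rw [res_pfisterCoeff] at ha
      -- First residue forms are compared: the one of `φ₂` with unit slots is anisotropic of full
      -- dimension, the one coming from the divisor has half that dimension.
      have h4 := card_le_of_isAniso v h2 hπ (h3.graded_swap v hπ.ne_zero) ha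
      have h5 := h3.card_eq
      rw [Fintype.card_sum] at h4
      rw [Fintype.card_sum, Fintype.card_sum, Fintype.card_sum, Fintype.card_sum,
        Fintype.card_empty] at h5
      have h6 : 0 < Fintype.card (Finset (Fin (n + 1 + 1))) := Fintype.card_pos
      omega
    · obtain ⟨m, hm, f, a, hf, h⟩ := exists_slot_res_eq_one v _ ha
      obtain rfl : n + 1 = m := by omega
      obtain ⟨x, a, rfl⟩ : ∃ x a', a = Fin.cons x a' := ⟨_, _, (Fin.cons_self_tail a).symm⟩
      exact key _ f a hf (hφ₂'.trans (h.trans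
        (((diagIso_pfisterCoeff_cons_units v x a).symm.dbl _).trans (dbl_comm _ _ _))))
  · have hφ₂' := hφ₂
    rw [dbl_units_eq_graded] at hφ₂'
    -- With a uniformizer slot, the second residue form is a scalar multiple of the residue Pfister
    -- form of the unit slots. As `φ₂` is unramified, that Pfister form is isotropic.
    have h3 := not_isAniso_of_isHyperbolic (isHyperbolic_of_not_isRamified v hπ hφ₂' hr₂)
    have h4 : ¬ IsAniso (pfisterCoeff fun i => res v (a₂' i)) := by
      intro ha
      refine h3 ?_
      convert smul_isAniso (res_ne_zero v (-u₂)) ha using 1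
      rw [res_pfisterCoeff]
      ext S
      exact res_mul v _ _
    obtain ⟨m, hm, f, a, hf, h⟩ := exists_slot_res_eq_one v _ h4
    obtain rfl : n = m := by omega
    exact key _ f a hf (hφ₂.trans (h.dbl _))

theorem exists_divisor_of_differentRamification (hv : (2 : ResField v) ≠ 0) {n : ℕ}
    (h₂ : IsPfister (n + 2) φ₂) (hr₂ : IsRamified v φ₂)
    (h : DifferentRamification v (n + 2) φ₁ φ₂) :
    ∃ γ : QuadraticForm F (Finset (Fin (n + 1)) → F), IsPfister (n + 1) γ ∧
      ((Divides γ φ₁ ∧ ¬ Divides γ φ₂) ∨ (Divides γ φ₂ ∧ ¬ Divides γ φ₁)) := by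
  classical
  have h2 : (2 : F) ≠ 0 := Invertible.ne_zero 2
  obtain ⟨ρ₁, ρ₂, ⟨e₁, a₁, b₁, hb₁, hφ₁, hρ₁⟩, ⟨e₂, a₂, b₂, hb₂, hφ₂, hρ₂⟩, hne⟩ := h
  -- The number of slots of a residue form is forced by its dimension, a power of two.
  have hdim : ∀ {e : ℕ} {ρ : QuadraticForm (ResField v) (Finset (Fin (n + 1)) → ResField v)}
      {a : Fin e → ResField v}, ρ.Equivalent (pfister a) → e = n + 1 := by
    rintro e ρ a ⟨f⟩
    have := f.toLinearEquiv.finrank_eq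
    simp only [Module.finrank_fintype_fun_eq_card, Fintype.card_finset, Fintype.card_fin] at this
    exact (Nat.pow_right_injective le_rfl this).symm
  obtain rfl := hdim hρ₁
  obtain rfl := hdim hρ₂
  replace hφ₁ := QuadraticMap.Equivalent.trans hφ₁ (pfisterCoeff_snoc _ _)
  replace hφ₂ := QuadraticMap.Equivalent.trans hφ₂ (pfisterCoeff_snoc _ _)
  refine ⟨pfister fun i => toF v (a₁ i), isPfister_pfister fun i => toF_ne_zero v _,
    Or.inl ⟨divides_of_equivalent_dbl hφ₁, fun hdiv => ?_⟩⟩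
  -- An isotropic residue form would give a slot of residue 1, contradicting ramification of `φ₂`.
  have hani : IsAniso (pfisterCoeff fun i => res v (a₂ i)) := by
    by_contra ha
    obtain ⟨m, hm, f, a, hf, h⟩ := exists_slot_res_eq_one v _ ha
    refine not_isRamified_of_dbl v h2 hv (c := dbl (-b₂) (pfisterCoeff fun i => toF v (a i))) ?_ hf
      (hφ₂.trans ((h.dbl _).trans (dbl_comm _ _ _))) hr₂
    have := pfisterCoeff_ne_zero fun i => toF_ne_zero v (a i)
    rintro (i | i) <;> simp [dbl, this, hb₂.ne_zero]
  have hφ₂' := hφ₂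
  rw [← mul_one b₂, show (1 : F) = toF v 1 from rfl, dbl_units_eq_graded] at hφ₂'
  rw [res_pfisterCoeff] at hani
  obtain ⟨r, δ, hδ⟩ := Divides.exists_diagForm (a := pfisterCoeff fun i => toF v (a₁ i)) hdiv
  obtain ⟨a', ha', hφa'⟩ := h₂
  have hδ0 : ∀ j, δ j ≠ 0 := fun j => by
    have h3 : DiagIso (pfisterCoeff a') _ := QuadraticMap.Equivalent.trans hφa'.symm hδ
    exact right_ne_zero_of_mul (h3.ne_zero h2 (pfisterCoeff_ne_zero ha') (∅, j))
  obtain ⟨p, e, u, w, t, ht, htδ⟩ := exists_graded v hb₂ hδ0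
  have h4 : DiagIso (graded v b₂ (fun q : Finset (Fin (n + 1)) × {i // p i} =>
      pfisterCoeff a₁ q.1 * u q.2) fun q : Finset (Fin (n + 1)) × {i // ¬ p i} =>
      pfisterCoeff a₁ q.1 * w q.2) (graded v b₂ (pfisterCoeff a₂) fun S =>
        -1 * pfisterCoeff a₂ S) := by
    refine DiagIso.trans (DiagIso.symm ?_) (hδ.symm.trans hφ₂')
    rw [toF_pfisterCoeff]
    refine diagIso_of_equiv_sq (((Equiv.refl _).prodCongr e).trans (Equiv.prodSumDistrib _ _ _))
      (fun q => t q.2) (fun q => ht _) ?_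
    rintro ⟨S, j⟩
    rw [htδ]
    rcases he : e j with i | i <;> simp [graded, he, toF_mul] <;> ring
  have hani' : IsAniso fun S => res v (-1 * pfisterCoeff a₂ S) := by
    convert smul_isAniso (res_ne_zero v (-1)) hani using 1
    ext S
    exact res_mul v _ _
  -- Each residue form of `φ₂` is anisotropic of dimension `2^(n+1)`, and the residue forms of `γ ⊗
  -- δ` have dimensions `2^(n+1)` times those of `δ`. So each residue form of `δ` has dimension at
  -- least 1, and these dimensions add up to 2.
  have h5 := card_le_of_isAniso v h2 hb₂ h4 hani'
  have h6 := card_le_of_isAniso v h2 hb₂ (h4.graded_swap v hb₂.ne_zero) hani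
  have h7 := h4.card_eq
  have hpos : 0 < Fintype.card (Finset (Fin (n + 1))) := Fintype.card_pos
  rw [Fintype.card_prod] at h5 h6
  rw [Fintype.card_sum, Fintype.card_sum, Fintype.card_prod, Fintype.card_prod] at h7
  have h8 : Fintype.card {i // ¬ p i} = 1 := by
    refine le_antisymm ?_ (Nat.pos_of_ne_zero fun h0 => ?_)
    · exact Nat.le_of_mul_le_mul_left (by omega) hpos
    · rw [h0] at h5
      omega
  have h9 := diagIso_res_of_isAniso v h2 hb₂ h4 hani' (by rw [Fintype.card_prod, h8, mul_one])
  obtain ⟨j, hj⟩ := Fintype.card_eq_one_iff.1 h8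
  -- With `w` the single second residue entry of `δ`, `w̄ r(φ₁) ≅ -r(φ₂)`; the scalar `-w̄` is then
  -- removed by roundness.
  refine hne (QuadraticMap.Equivalent.trans hρ₁ (QuadraticMap.Equivalent.trans
    (diagIso_of_smul_diagIso (g := -res v (w j)) (neg_ne_zero.2 (res_ne_zero v _)) ?_) hρ₂.symm))
  have : Unique {i // ¬ p i} := ⟨⟨j⟩, hj⟩
  refine DiagIso.trans (diagIso_of_equiv (Equiv.prodUnique _ {i // ¬ p i}).symm fun S => ?_)
    ((h9.smul (-1)).trans (diagIso_of_eq fun S => ?_))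
  · rw [res_pfisterCoeff]
    simp [res_mul, hj default, mul_comm]
  · rw [res_pfisterCoeff]
    simp [res_neg]

end Divisors
end PfisterRam

theorem mainTheorem11 {F Γ V₁ V₂ : Type*} [Field F] [Invertible (2 : F)]
    [LinearOrderedCommGroupWithZero Γ] (v : Valuation F Γ) [v.IsRankOneDiscrete]
    (hv : ringChar (PfisterRam.ResField v) ≠ 2)
    [AddCommGroup V₁] [Module F V₁] [AddCommGroup V₂] [Module F V₂]
    (d : ℕ) (hd : 2 ≤ d) (φ₁ : QuadraticForm F V₁) (φ₂ : QuadraticForm F V₂)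
    (h₁ : PfisterRam.IsPfister d φ₁) (h₂ : PfisterRam.IsPfister d φ₂)
    (h : (PfisterRam.IsRamified v φ₁ ∧ ¬ PfisterRam.IsRamified v φ₂) ∨
      (PfisterRam.IsRamified v φ₁ ∧ PfisterRam.IsRamified v φ₂ ∧
        PfisterRam.DifferentRamification v d φ₁ φ₂)) :
    ∃ γ : QuadraticForm F (Finset (Fin (d - 1)) → F), PfisterRam.IsPfister (d - 1) γ ∧
      ((PfisterRam.Divides γ φ₁ ∧ ¬ PfisterRam.Divides γ φ₂) ∨
        (PfisterRam.Divides γ φ₂ ∧ ¬ PfisterRam.Divides γ φ₁)) := by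
  obtain ⟨n, rfl⟩ := Nat.exists_eq_add_of_le' hd
  have hv' : (2 : PfisterRam.ResField v) ≠ 0 := Ring.two_ne_zero hv
  rcases h with ⟨hr₁, hr₂⟩ | ⟨-, hr₂, hdiff⟩
  · exact PfisterRam.exists_divisor_of_not_isRamified v hv' h₁ h₂ hr₁ hr₂
  · exact PfisterRam.exists_divisor_of_differentRamification v hv' h₂ hr₂ hdiff
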